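/- **Theorem 1.** Let $X_1,X_2,\dots$ be independent real random variables with common distribution function $F$. For $\gamma\in\mathbb R$ let $G_\gamma$ be the extreme value distribution function, $G_\gamma(x)=\exp\{-(1+\gamma x)^{-1/\gamma}\}$ for $1+\gamma x>0$ if $\gamma\neq0$ (extended by $0$ to the left of this range if $\gamma>0$ and by $1$ to the right of it if $\gamma<0$) and $G_0(x)=\exp(-e^{-x})$. Suppose that $\gamma<1$ and that $F$ is in the domain of attraction of $G_\gamma$, that is, there are $a_n>0$ and $b_n\in\mathbb R$ with $F^n(a_nx+b_n)\to G_\gamma(x)$ as $n\to\infty$ for all $x$. Let $0<c<1$ and let $\lambda\in\Lambda$, the class of signed Borel measures on $(0,1]$ with $$\lambda((0,1])=0,\qquad \int_{(0,1]}\log(1/t)\,|\lambda|(dt)<\infty,\qquad \int_{(0,1]}\log(1/t)\,\lambda(dt)=1 .$$ Let $X^{(n)}_1\ge X^{(n)}_2\ge\dots\ge X^{(n)}_n$ be the descending order statistics of $X_1,\dots,X_n$, let $Y^{(n)}_k=\frac1k\sum_{i=1}^kX^{(n)}_i$ for $1\le k\le n$ (the CVaR order statistics), and put $\log 0:=0$.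 Then for every sequence of positive integers $m=m(n)$ with $m\to\infty$ and $m/n\to0$, $$\int_{(0,1]}\log\bigl(Y^{(n)}_{\lfloor c\lceil tm\rceil\rfloor+1}-Y^{(n)}_{\lceil tm\rceil+1}\bigr)\,\lambda(dt)\ \xrightarrow{\ p\ }\ \gamma\qquad(n\to\infty).$$ Moreover, if for all large $n$ one has $\lfloor c\lceil tm\rceil\rfloor\ge1$ for $|\lambda|$-almost every $t\in(0,1]$ (so that no $Y^{(n)}_0$ occurs), then also $$\int_{(0,1]}\log\bigl(Y^{(n)}_{\lfloor c\lceil tm\rceil\rfloor}-Y^{(n)}_{\lceil tm\rceil}\bigr)\,\lambda(dt)\ \xrightarrow{\ p\ }\ \gamma\qquad(n\to\infty).$$ -/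

import Mathlib

open MeasureTheory ProbabilityTheory Filter Topology

noncomputable section

/-- The generalized extreme value distribution function `G_γ` on the whole line: where
`1 + γ x ≤ 0` it is `0` if `γ > 0` (left of the support) and `1` if `γ < 0` (right of it). -/
def gevCDF (γ x : ℝ) : ℝ :=
  if γ = 0 then Real.exp (-Real.exp (-x))
  else if 0 < 1 + γ * x then Real.exp (-(1 + γ * x) ^ (-1 / γ))
  else if 0 < γ then 0 else 1

/-- The distribution function `F` is in the domain of attraction of `G_γ`. -/
def InDomainOfAttraction (F : ℝ → ℝ) (γ : ℝ) : Prop :=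
  ∃ a b : ℕ → ℝ, (∀ n, 0 < a n) ∧
    ∀ x : ℝ, Tendsto (fun n : ℕ => F (a n * x + b n) ^ n) atTop (𝓝 (gevCDF γ x))

/-- The class `Λ` of signed Borel measures on `(0, 1]` with total mass `0`, with
`∫ log (1 / t) |λ|(dt) < ∞` and `∫ log (1 / t) λ(dt) = 1`. -/
def weightClass : Set (SignedMeasure (Set.Ioc (0 : ℝ) 1)) :=
  {ν | ν Set.univ = 0 ∧
    ν.Integrable (fun t => Real.log (1 / (t : ℝ))) ∧
    ∫ᵛ t, Real.log (1 / (t : ℝ)) ∂<•ν = 1}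

/-- The `k`-th descending order statistic of `x 0, …, x (n - 1)`, for `1 ≤ k ≤ n`:
`k = 1` gives the maximum. (`Tuple.sort` sorts in ascending order.) -/
def descOrderStat (x : ℕ → ℝ) (n k : ℕ) : ℝ :=
  if h : 1 ≤ k ∧ k ≤ n then
    ((fun i : Fin n => x i) ∘ Tuple.sort (fun i : Fin n => x i)) ⟨n - k, by omega⟩
  else 0

/-- The CVaR order statistic `Y_k`, for `1 ≤ k ≤ n`: the average of the `k` largest among
`x 0, …, x (n - 1)`. -/
def cvarOrderStat (x : ℕ → ℝ) (n k : ℕ) : ℝ :=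
  (1 / (k : ℝ)) * ∑ i ∈ Finset.Icc 1 k, descOrderStat x n i

/-- The CVaR-based smoothed estimator
`∫ log (Y_{⌊c ⌈t m⌉⌋ + d} - Y_{⌈t m⌉ + d}) λ(dt)` computed from `x 0, …, x (n - 1)`, where `d` is
the index of the order statistic from which one starts to count (so that `log 0 = 0`, as in
`Real.log`, is used only in case of ties). -/
def cvarEstimator (d : ℕ) (c : ℝ) (ν : SignedMeasure (Set.Ioc (0 : ℝ) 1)) (m n : ℕ)
    (x : ℕ → ℝ) : ℝ :=
  ∫ᵛ t, Real.log (cvarOrderStat x n (⌊c * (⌈(t : ℝ) * (m : ℝ)⌉₊ : ℝ)⌋₊ + d)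
      - cvarOrderStat x n (⌈(t : ℝ) * (m : ℝ)⌉₊ + d)) ∂<•ν

/-- Intermediate sequences: `m n → ∞` and `m n / n → 0`. Hence `1 ≤ m n ≤ n - 1` for all
large `n`, which is all that matters for a limit. -/
def IsIntermediate (m : ℕ → ℕ) : Prop :=
  Tendsto m atTop atTop ∧ Tendsto (fun n : ℕ => (m n : ℝ) / (n : ℝ)) atTop (𝓝 0)

end

/-! Write `V` for `gevTailQuantile γ`, `A` for `gevExcess γ`, and let `p` be the integer part of `n
/ m`. Attraction to `G_γ` says that the level `a q * V s + b q` is exceeded by one observation with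
probability about `s / q`. Hence, in probability, a rank `k` with `k / m → s > 0` satisfies `(X_k -
b p) / a p → V s`. The mean of the `k` largest adds the mean excess above `X_k`, so `(Y_k - b p) / a
p → V s + A s / s`. By the scaling of `V` and `A`, the normalized gap between the ranks near `c * t
* m` and `t * m` tends to `V c / (1 - γ) * t ^ (-γ)`. Its logarithm is a constant plus `γ * log (1 /
t)`. Since `ν` has total mass zero, the constant and `log (a p)` integrate to `0`; the other
normalization leaves `γ`.

For the means, the total excess between two levels is squeezed between Riemann sums of exceedance
counts, to which Chebyshev applies (`tendsto_relExcess_sub`). The extreme part is small by Markov's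
inequality and a first moment bound, where `γ < 1` makes a geometric series converge
(`exists_lintegral_excess_le`). No second moment of the observations is needed.

To pass to the limit under the integral, the logarithm of the gap must be dominated, for all `t` on
one event of high probability, by `K + D * log (1 / t)`. This follows from bounds on the gap by
powers of `k / m`. The upper one comes from a single total excess. The lower one uses exceedance
counts at all dyadic scales when `m ≤ k ^ 2`, and the spacing of the two largest observations when
`k ^ 2 < m` (`exists_eventually_le_gap`). Convergence in probability is convergence along the filter
`whp P`, so limits, squeezes and dominated convergence are applied to it directly. -/

/-! ### Limit functions of extreme value theory -/

/-- The inverse `V` of `x ↦ -log (G_γ x)`. -/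
noncomputable def gevTailQuantile (γ s : ℝ) : ℝ :=
  if γ = 0 then -Real.log s else (s ^ (-γ) - 1) / γ

/-- The mean excess `∫_{V s}^∞ -log (G_γ x) dx`. -/
noncomputable def gevExcess (γ s : ℝ) : ℝ := s ^ (1 - γ) / (1 - γ)

theorem one_add_mul_gevTailQuantile (γ s : ℝ) :
    1 + γ * gevTailQuantile γ s = s ^ (-γ) := by
  unfold gevTailQuantile
  split_ifs with h
  · simp [h]
  · field_simp
    ring

theorem gevCDF_gevTailQuantile {γ s : ℝ} (hs : 0 < s) :
    gevCDF γ (gevTailQuantile γ s) = Real.exp (-s) := by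
  have h1 := one_add_mul_gevTailQuantile γ s
  unfold gevCDF
  rw [h1, if_pos (Real.rpow_pos_of_pos hs _)]
  split_ifs with h
  · simp [gevTailQuantile, h, Real.exp_log hs]
  · rw [← Real.rpow_mul hs.le, show -γ * (-1 / γ) = 1 by field_simp, Real.rpow_one]

@[simp] theorem gevTailQuantile_one (γ : ℝ) : gevTailQuantile γ 1 = 0 := by
  simp [gevTailQuantile]

theorem hasDerivAt_gevTailQuantile {γ s : ℝ} (hs : 0 < s) :
    HasDerivAt (gevTailQuantile γ) (-s ^ (-γ - 1)) s := by
  by_cases h : γ = 0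
  · have : gevTailQuantile γ = fun s => -Real.log s := by
      ext; simp [gevTailQuantile, h]
    rw [this]
    exact (Real.hasDerivAt_log hs.ne').neg.congr_deriv (by simp [h, Real.rpow_neg_one])
  · have : gevTailQuantile γ = fun s => (s ^ (-γ) - 1) / γ := by
      ext; simp [gevTailQuantile, h]
    rw [this]
    exact (((Real.hasDerivAt_rpow_const (p := -γ) (Or.inl hs.ne')).sub_const 1).div_const γ
      ).congr_deriv (by field_simp)

theorem continuousAt_gevTailQuantile {γ s : ℝ} (hs : 0 < s) :
    ContinuousAt (gevTailQuantile γ) s :=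
  (hasDerivAt_gevTailQuantile hs).continuousAt

theorem gevTailQuantile_strictAntiOn (γ : ℝ) :
    StrictAntiOn (gevTailQuantile γ) (Set.Ioi 0) := by
  refine strictAntiOn_of_deriv_neg (convex_Ioi 0)
    (fun s hs => (continuousAt_gevTailQuantile hs).continuousWithinAt) fun s hs => ?_
  rw [interior_Ioi] at hs
  rw [(hasDerivAt_gevTailQuantile hs).deriv]
  exact neg_neg_of_pos (Real.rpow_pos_of_pos hs _)

theorem gevTailQuantile_lt {γ s t : ℝ} (hs : 0 < s) (hst : s < t) :
    gevTailQuantile γ t < gevTailQuantile γ s :=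
  gevTailQuantile_strictAntiOn γ hs (hs.trans hst) hst

theorem gevTailQuantile_pos {γ s : ℝ} (hs : 0 < s) (hs1 : s < 1) : 0 < gevTailQuantile γ s := by
  simpa using gevTailQuantile_lt (γ := γ) hs hs1

/-- Self-similarity of `V`: the source of the factor `t ^ (-γ)` in the limiting gap. -/
theorem gevTailQuantile_mul_sub {γ c s : ℝ} (hc : 0 < c) (hs : 0 < s) :
    gevTailQuantile γ (c * s) - gevTailQuantile γ s = s ^ (-γ) * gevTailQuantile γ c := by
  unfold gevTailQuantile
  split_ifs with h
  · simp [h, Real.log_mul hc.ne' hs.ne']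
  · rw [Real.mul_rpow hc.le hs.le]
    field_simp
    ring

theorem gevTailQuantile_half (γ : ℝ) :
    gevTailQuantile γ (1 / 2) = -2 ^ γ * gevTailQuantile γ 2 := by
  have h := gevTailQuantile_mul_sub (γ := γ) (c := 1 / 2) (s := 2) (by norm_num) (by norm_num)
  norm_num at h
  rw [show -2 ^ γ * gevTailQuantile γ 2 = 2 ^ γ * -gevTailQuantile γ 2 by ring, h,
    ← mul_assoc, ← Real.rpow_add two_pos]
  norm_num

theorem hasDerivAt_gevExcess {γ s : ℝ} (hγ : γ < 1) (hs : 0 < s) :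
    HasDerivAt (gevExcess γ) (s ^ (-γ)) s := by
  have h1 : 1 - γ ≠ 0 := by linarith
  refine ((Real.hasDerivAt_rpow_const (p := 1 - γ) (Or.inl hs.ne')).div_const (1 - γ)).congr_deriv
    ?_
  rw [show 1 - γ - 1 = -γ by ring]
  field_simp

theorem continuousAt_gevExcess {γ s : ℝ} (hγ : γ < 1) (hs : 0 < s) :
    ContinuousAt (gevExcess γ) s :=
  (hasDerivAt_gevExcess hγ hs).continuousAt

theorem tendsto_gevExcess_zero {γ : ℝ} (hγ : γ < 1) :
    Tendsto (gevExcess γ) (𝓝 0) (𝓝 0) := by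
  have h1 : 0 < 1 - γ := by linarith
  have := (Real.continuousAt_rpow_const (0 : ℝ) (1 - γ) (Or.inr h1.le)).tendsto.div_const (1 - γ)
  rw [Real.zero_rpow h1.ne', zero_div] at this
  exact this

theorem gevExcess_nonneg {γ s : ℝ} (hγ : γ < 1) (hs : 0 ≤ s) : 0 ≤ gevExcess γ s :=
  div_nonneg (Real.rpow_nonneg hs _) (by linarith)

/-- Since `A' = -s * V'`, the derivative changes sign exactly at `r`. With `r` at an endpoint of an
interval, monotonicity compares increments of `A` with those of `V`, which is what the Riemann sums
need. -/
theorem hasDerivAt_gevExcess_add_mul {γ r s : ℝ} (hγ : γ < 1) (hs : 0 < s) :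
    HasDerivAt (fun u => gevExcess γ u + r * gevTailQuantile γ u) ((s - r) * s ^ (-γ - 1)) s := by
  refine ((hasDerivAt_gevExcess hγ hs).add
    ((hasDerivAt_gevTailQuantile hs).const_mul r)).congr_deriv ?_
  rw [show s ^ (-γ) = s * s ^ (-γ - 1) by
    nth_rewrite 2 [← Real.rpow_one s]
    rw [← Real.rpow_add hs]; ring_nf]
  ring

theorem gevExcess_sub_le {γ s t : ℝ} (hγ : γ < 1) (hs : 0 < s) (hst : s ≤ t) :
    gevExcess γ t - gevExcess γ s ≤ t * (gevTailQuantile γ s - gevTailQuantile γ t) := by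
  have h : AntitoneOn (fun u => gevExcess γ u + t * gevTailQuantile γ u) (Set.Icc s t) := by
    refine antitoneOn_of_deriv_nonpos (convex_Icc s t) (fun u hu =>
      (hasDerivAt_gevExcess_add_mul hγ (hs.trans_le hu.1)).continuousAt.continuousWithinAt)
      (fun u hu => ?_) fun u hu => ?_
    all_goals rw [interior_Icc] at hu
    · exact (hasDerivAt_gevExcess_add_mul hγ
        (hs.trans hu.1)).differentiableAt.differentiableWithinAt
    · rw [(hasDerivAt_gevExcess_add_mul hγ (hs.trans hu.1)).deriv]
      exact mul_nonpos_of_nonpos_of_nonneg (by linarith [hu.2])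
        (Real.rpow_nonneg (hs.trans hu.1).le _)
  have := h (Set.left_mem_Icc.2 hst) (Set.right_mem_Icc.2 hst) hst
  simp only at this
  linarith

theorem le_gevExcess_sub {γ s t : ℝ} (hγ : γ < 1) (hs : 0 < s) (hst : s ≤ t) :
    s * (gevTailQuantile γ s - gevTailQuantile γ t) ≤ gevExcess γ t - gevExcess γ s := by
  have h : MonotoneOn (fun u => gevExcess γ u + s * gevTailQuantile γ u) (Set.Icc s t) := by
    refine monotoneOn_of_deriv_nonneg (convex_Icc s t) (fun u hu =>
      (hasDerivAt_gevExcess_add_mul hγ (hs.trans_le hu.1)).continuousAt.continuousWithinAt)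
      (fun u hu => ?_) fun u hu => ?_
    all_goals rw [interior_Icc] at hu
    · exact (hasDerivAt_gevExcess_add_mul hγ
        (hs.trans hu.1)).differentiableAt.differentiableWithinAt
    · rw [(hasDerivAt_gevExcess_add_mul hγ (hs.trans hu.1)).deriv]
      exact mul_nonneg (by linarith [hu.1]) (Real.rpow_nonneg (hs.trans hu.1).le _)
  have := h (Set.left_mem_Icc.2 hst) (Set.right_mem_Icc.2 hst) hst
  simp only at this
  linarith

/-- The limit of normalized CVaR order statistics of relative rank `s`. -/
noncomputable def gevCVaR (γ s : ℝ) : ℝ := gevTailQuantile γ s + gevExcess γ s / s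

theorem gevCVaR_mul_sub {γ c t : ℝ} (hγ : γ < 1) (hc : 0 < c) (ht : 0 < t) :
    gevCVaR γ (c * t) - gevCVaR γ t = gevTailQuantile γ c / (1 - γ) * t ^ (-γ) := by
  have h1 : 1 - γ ≠ 0 := by linarith
  have key : ∀ s : ℝ, 0 < s → gevExcess γ s / s = s ^ (-γ) / (1 - γ) := fun s hs => by
    rw [gevExcess, sub_eq_add_neg 1 γ, Real.rpow_add hs, Real.rpow_one]
    field_simp
  rw [gevCVaR, gevCVaR, key _ (mul_pos hc ht), key _ ht, Real.mul_rpow hc.le ht.le]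
  have h2 := gevTailQuantile_mul_sub (γ := γ) hc ht
  have h3 := one_add_mul_gevTailQuantile γ c
  rw [← h3]
  field_simp
  linear_combination (1 - γ) * h2

/-! ### Order statistics, exceedance counts and total excesses -/

/-- The number of exceedances of the level `u` among `x 0, …, x (n - 1)`. -/
noncomputable def exceedCount (x : ℕ → ℝ) (n : ℕ) (u : ℝ) : ℕ :=
  ((Finset.range n).filter fun i => u < x i).card

/-- The total excess over the level `u` of `x 0, …, x (n - 1)`. -/
noncomputable def totalExcess (x : ℕ → ℝ) (n : ℕ) (u : ℝ) : ℝ :=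
  ∑ i ∈ Finset.range n, max (x i - u) 0

section OrderStatistics

variable {x : ℕ → ℝ} {n : ℕ}

theorem descOrderStat_eq {k : ℕ} (hk : 1 ≤ k) (hkn : k ≤ n) :
    descOrderStat x n k =
      ((fun i : Fin n => x i) ∘ Tuple.sort (fun i : Fin n => x i)) ⟨n - k, by omega⟩ := by
  rw [descOrderStat, dif_pos ⟨hk, hkn⟩]

theorem descOrderStat_anti {k l : ℕ} (hk : 1 ≤ k) (hkl : k ≤ l) (hln : l ≤ n) :
    descOrderStat x n l ≤ descOrderStat x n k := by
  rw [descOrderStat_eq hk (hkl.trans hln), descOrderStat_eq (hk.trans hkl) hln]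
  exact Tuple.monotone_sort (fun i : Fin n => x i) (by rw [Fin.le_def]; simp only; omega)

/-- Sorting is a permutation and `i ↦ n - i` reverses it. Indicators as `φ` give counts, truncated
differences give total excesses. -/
theorem sum_descOrderStat (φ : ℝ → ℝ) :
    ∑ i ∈ Finset.Icc 1 n, φ (descOrderStat x n i) = ∑ i ∈ Finset.range n, φ (x i) := by
  rw [Finset.sum_range, ← Equiv.sum_comp (Tuple.sort fun i : Fin n => x i)]
  refine Finset.sum_bij' (fun i hi => ⟨n - i, by rw [Finset.mem_Icc] at hi; omega⟩)
    (fun j _ => n - j.1) ?_ ?_ ?_ ?_ ?_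
  · simp
  · intro j _
    rw [Finset.mem_Icc]
    omega
  · intro i hi
    rw [Finset.mem_Icc] at hi
    simp only
    omega
  · intro j _
    ext
    simp only
    omega
  · intro i hi
    rw [Finset.mem_Icc] at hi
    rw [descOrderStat_eq hi.1 hi.2]
    rfl

theorem exceedCount_eq_card_Icc (u : ℝ) :
    exceedCount x n u = ((Finset.Icc 1 n).filter fun i => u < descOrderStat x n i).card := by
  have h := sum_descOrderStat (x := x) (n := n) fun y => if u < y then (1 : ℝ) else 0
  rw [Finset.sum_boole, Finset.sum_boole] at h
  exact_mod_cast h.symm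

theorem lt_descOrderStat_iff {k : ℕ} (hk : 1 ≤ k) (hkn : k ≤ n) (u : ℝ) :
    u < descOrderStat x n k ↔ k ≤ exceedCount x n u := by
  rw [exceedCount_eq_card_Icc]
  constructor
  · intro h
    have : Finset.Icc 1 k ⊆ (Finset.Icc 1 n).filter fun i => u < descOrderStat x n i := by
      intro i hi
      rw [Finset.mem_Icc] at hi
      rw [Finset.mem_filter, Finset.mem_Icc]
      exact ⟨⟨hi.1, hi.2.trans hkn⟩, h.trans_le (descOrderStat_anti hi.1 hi.2 hkn)⟩
    simpa using Finset.card_le_card this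
  · intro h
    by_contra hu
    have : ((Finset.Icc 1 n).filter fun i => u < descOrderStat x n i) ⊆ Finset.Ico 1 k := by
      intro i hi
      rw [Finset.mem_filter, Finset.mem_Icc] at hi
      rw [Finset.mem_Ico]
      refine ⟨hi.1.1, not_le.1 fun hki => hu (hi.2.trans_le (descOrderStat_anti hk hki hi.1.2))⟩
    have := Finset.card_le_card this
    rw [Nat.card_Ico] at this
    omega

theorem descOrderStat_le_iff {k : ℕ} (hk : 1 ≤ k) (hkn : k ≤ n) (u : ℝ) :
    descOrderStat x n k ≤ u ↔ exceedCount x n u < k := by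
  rw [← not_lt, lt_descOrderStat_iff hk hkn, not_le]

theorem mul_cvarOrderStat {k : ℕ} (hk : 1 ≤ k) :
    (k : ℝ) * cvarOrderStat x n k = ∑ i ∈ Finset.Icc 1 k, descOrderStat x n i := by
  have : (k : ℝ) ≠ 0 := by positivity
  rw [cvarOrderStat]
  field_simp

theorem mul_cvarOrderStat_sub {k : ℕ} (hk : 1 ≤ k) (u : ℝ) :
    (k : ℝ) * (cvarOrderStat x n k - u) = ∑ i ∈ Finset.Icc 1 k, (descOrderStat x n i - u) := by
  rw [mul_sub, mul_cvarOrderStat hk]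
  simp [Finset.sum_sub_distrib]

theorem mul_cvarOrderStat_sub_le {k : ℕ} (hk : 1 ≤ k) (hkn : k ≤ n) (u : ℝ) :
    (k : ℝ) * (cvarOrderStat x n k - u) ≤ totalExcess x n u := by
  rw [mul_cvarOrderStat_sub hk, totalExcess, ← sum_descOrderStat (fun y => max (y - u) 0)]
  calc _ ≤ ∑ i ∈ Finset.Icc 1 k, max (descOrderStat x n i - u) 0 :=
        Finset.sum_le_sum fun i _ => le_max_left _ _
    _ ≤ _ := Finset.sum_le_sum_of_subset_of_nonneg (Finset.Icc_subset_Icc_right hkn)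
        fun i _ _ => le_max_right _ _

/-- Above the level `X_k` only the `k` largest can contribute, ties contributing zero. For an
arbitrary level only the inequality `mul_cvarOrderStat_sub_le` is left. -/
theorem mul_cvarOrderStat_sub_descOrderStat {k : ℕ} (hk : 1 ≤ k) (hkn : k ≤ n) :
    (k : ℝ) * (cvarOrderStat x n k - descOrderStat x n k) =
      totalExcess x n (descOrderStat x n k) := by
  rw [mul_cvarOrderStat_sub hk, totalExcess,
    ← sum_descOrderStat (fun y => max (y - descOrderStat x n k) 0),
    ← Finset.sum_subset (Finset.Icc_subset_Icc_right hkn)]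
  · refine Finset.sum_congr rfl fun i hi => ?_
    rw [Finset.mem_Icc] at hi
    rw [max_eq_left (sub_nonneg.2 (descOrderStat_anti hi.1 hi.2 hkn))]
  · intro i hi hi'
    rw [Finset.mem_Icc] at hi hi'
    exact max_eq_right (sub_nonpos.2 (descOrderStat_anti hk (by omega) hi.2))

theorem descOrderStat_le_cvarOrderStat {k : ℕ} (hk : 1 ≤ k) (hkn : k ≤ n) :
    descOrderStat x n k ≤ cvarOrderStat x n k := by
  have h := mul_cvarOrderStat_sub_descOrderStat (x := x) hk hkn
  have h0 : 0 ≤ totalExcess x n (descOrderStat x n k) :=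
    Finset.sum_nonneg fun i _ => le_max_right _ _
  have hk' : (0 : ℝ) < k := by exact_mod_cast hk
  rw [← h] at h0
  exact sub_nonneg.1 (nonneg_of_mul_nonneg_right h0 hk')

theorem totalExcess_antitone : Antitone (totalExcess x n) := fun u v huv =>
  Finset.sum_le_sum fun i _ => max_le_max (by linarith) le_rfl

theorem totalExcess_sub_le (u v : ℝ) :
    totalExcess x n u - totalExcess x n v ≤ exceedCount x n u * (v - u) := by
  rw [totalExcess, totalExcess, ← Finset.sum_sub_distrib, exceedCount, ← nsmul_eq_mul,
    ← Finset.sum_const, Finset.sum_filter]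
  refine Finset.sum_le_sum fun i _ => ?_
  split_ifs with h
  · rw [max_eq_left (by linarith)]
    linarith [le_max_left (x i - v) 0]
  · rw [max_eq_right (by linarith)]
    linarith [le_max_right (x i - v) 0]

theorem le_totalExcess_sub {u v : ℝ} (huv : u ≤ v) :
    exceedCount x n v * (v - u) ≤ totalExcess x n u - totalExcess x n v := by
  rw [totalExcess, totalExcess, ← Finset.sum_sub_distrib, exceedCount, ← nsmul_eq_mul,
    ← Finset.sum_const, Finset.sum_filter]
  refine Finset.sum_le_sum fun i _ => ?_
  split_ifs with h
  · rw [max_eq_left (by linarith), max_eq_left (by linarith)]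
    linarith
  · rw [max_eq_right (a := x i - v) (by linarith)]
    linarith [le_max_right (x i - u) 0]

theorem mul_cvarOrderStat_sub_cvarOrderStat_le {j l : ℕ} {u : ℝ} (hj : 1 ≤ j) (hjl : j ≤ l)
    (hln : l ≤ n) (hu : u ≤ descOrderStat x n l) :
    (j : ℝ) * (cvarOrderStat x n j - cvarOrderStat x n l) ≤ totalExcess x n u := by
  refine le_trans ?_ (mul_cvarOrderStat_sub_le hj (hjl.trans hln) u)
  gcongr
  exact hu.trans (descOrderStat_le_cvarOrderStat (hj.trans hjl) hln)

/-- The gap between two CVaR order statistics dominates a gap between order statistics. -/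
theorem mul_descOrderStat_sub_le_cvarOrderStat_sub {i j l : ℕ} (hi : 1 ≤ i) (hij : i ≤ j)
    (hjl : j < l) (hln : l ≤ n) :
    ((l : ℝ) - j) / l * (i / j) * (descOrderStat x n i - descOrderStat x n (j + 1)) ≤
      cvarOrderStat x n j - cvarOrderStat x n l := by
  -- Centred at `v`, the first `j` terms are nonnegative and the later ones nonpositive. So `l *
  -- (Y_l - v) ≤ j * (Y_j - v)`, and the gap is at least `(1 - j / l) * (Y_j - v)`.
  set v := descOrderStat x n (j + 1)
  have hj : 1 ≤ j := hi.trans hij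
  have h1 : (i : ℝ) * (descOrderStat x n i - v) ≤ j * (cvarOrderStat x n j - v) := by
    rw [mul_cvarOrderStat_sub hj]
    calc (i : ℝ) * (descOrderStat x n i - v)
        = ∑ r ∈ Finset.Icc 1 i, (descOrderStat x n i - v) := by
            rw [Finset.sum_const, Nat.card_Icc, Nat.add_sub_cancel, nsmul_eq_mul]
      _ ≤ ∑ r ∈ Finset.Icc 1 i, (descOrderStat x n r - v) := by
          refine Finset.sum_le_sum fun r hr => ?_
          rw [Finset.mem_Icc] at hr
          linarith [descOrderStat_anti (x := x) hr.1 hr.2 (by omega : i ≤ n)]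
      _ ≤ _ := by
          refine Finset.sum_le_sum_of_subset_of_nonneg (Finset.Icc_subset_Icc_right hij) ?_
          intro r hr _
          rw [Finset.mem_Icc] at hr
          exact sub_nonneg.2 (descOrderStat_anti hr.1 (by omega) (by omega))
  have h2 : (l : ℝ) * (cvarOrderStat x n l - v) ≤ j * (cvarOrderStat x n j - v) := by
    rw [mul_cvarOrderStat_sub hj, mul_cvarOrderStat_sub (hj.trans hjl.le)]
    have hU : Finset.Icc 1 j ⊆ Finset.Icc 1 l := Finset.Icc_subset_Icc_right hjl.le
    rw [← Finset.sum_sdiff hU]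
    have : ∑ r ∈ Finset.Icc 1 l \ Finset.Icc 1 j, (descOrderStat x n r - v) ≤ 0 := by
      refine Finset.sum_nonpos fun r hr => ?_
      rw [Finset.mem_sdiff, Finset.mem_Icc, Finset.mem_Icc] at hr
      exact sub_nonpos.2 (descOrderStat_anti (by omega) (by omega) (by omega))
    linarith
  have hj' : (0 : ℝ) < j := by exact_mod_cast hj
  have hl' : (0 : ℝ) < l := by exact_mod_cast (hj.trans hjl.le)
  have hlj : (0 : ℝ) ≤ (l : ℝ) - j := by
    rw [sub_nonneg]; exact_mod_cast hjl.le
  have h3 : (i : ℝ) / j * (descOrderStat x n i - v) ≤ cvarOrderStat x n j - v := by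
    rw [div_mul_eq_mul_div, div_le_iff₀ hj']
    linarith
  have h4 : cvarOrderStat x n l - v ≤ j / l * (cvarOrderStat x n j - v) := by
    rw [div_mul_eq_mul_div, le_div_iff₀ hl']
    linarith
  calc ((l : ℝ) - j) / l * (i / j) * (descOrderStat x n i - v)
      = ((l : ℝ) - j) / l * (i / j * (descOrderStat x n i - v)) := by ring
    _ ≤ ((l : ℝ) - j) / l * (cvarOrderStat x n j - v) := by gcongr
    _ = (cvarOrderStat x n j - v) - j / l * (cvarOrderStat x n j - v) := by
        field_simp
    _ ≤ _ := by linarith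

end OrderStatistics

/-! ### Convergence in probability as convergence along a filter -/

/-- The filter of events of `ℕ × Ω` whose sections have probability tending to one. Convergence
along this filter is convergence in probability. -/
def whp {Ω : Type*} [MeasurableSpace Ω] (P : Measure Ω) : Filter (ℕ × Ω) where
  sets := {S | Tendsto (fun n => P {ω | (n, ω) ∉ S}) atTop (𝓝 0)}
  univ_sets := by simp
  sets_of_superset := fun {S T} hS hST =>
    tendsto_of_tendsto_of_tendsto_of_le_of_le tendsto_const_nhds hS (fun _ => zero_le)
      fun _ => measure_mono fun _ h h' => h (hST h')
  inter_sets := fun {S T} hS hT => by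
    have h := hS.add hT
    rw [add_zero] at h
    refine tendsto_of_tendsto_of_tendsto_of_le_of_le tendsto_const_nhds h (fun _ => zero_le)
      fun n => (measure_mono fun ω (hω : ¬ ((n, ω) ∈ S ∩ T)) => ?_).trans (measure_union_le _ _)
    by_cases h : (n, ω) ∈ S
    · exact Or.inr fun h' => hω ⟨h, h'⟩
    · exact Or.inl h

section WithHighProbability

variable {Ω : Type*} [MeasurableSpace Ω] {P : Measure Ω}

theorem eventually_whp_iff {p : ℕ × Ω → Prop} :
    (∀ᶠ z in whp P, p z) ↔ Tendsto (fun n => P {ω | ¬ p (n, ω)}) atTop (𝓝 0) :=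
  Iff.rfl

theorem eventually_whp_of_forall_eventually_le {p : ℕ × Ω → Prop}
    (h : ∀ ε : ℝ, 0 < ε → ∀ᶠ n in atTop, P {ω | ¬ p (n, ω)} ≤ ENNReal.ofReal ε) :
    ∀ᶠ z in whp P, p z := by
  rw [eventually_whp_iff, ENNReal.tendsto_nhds_zero]
  intro ε hε
  obtain ⟨δ, hδ0, hδ⟩ := ENNReal.lt_iff_exists_real_btwn.1 hε
  filter_upwards [h δ (by simpa using hδ.1)] with n hn
  exact hn.trans hδ.2.le

theorem eventually_whp_of_le {p : ℕ × Ω → Prop} {f : ℕ → ℝ} (hf : Tendsto f atTop (𝓝 0))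
    (h : ∀ᶠ n in atTop, P {ω | ¬ p (n, ω)} ≤ ENNReal.ofReal (f n)) :
    ∀ᶠ z in whp P, p z :=
  eventually_whp_of_forall_eventually_le fun ε hε => by
    filter_upwards [h, hf.eventually_lt_const hε] with n hn hn'
    exact hn.trans (ENNReal.ofReal_le_ofReal hn'.le)

theorem tendsto_fst_whp : Tendsto Prod.fst (whp P) atTop := by
  intro S hS
  change Tendsto _ _ _
  refine tendsto_const_nhds.congr' ?_
  filter_upwards [hS] with n hn
  simp [hn]

theorem eventually_whp_fst {p : ℕ → Prop} (h : ∀ᶠ n in atTop, p n) :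
    ∀ᶠ z : ℕ × Ω in whp P, p z.1 :=
  tendsto_fst_whp.eventually h

theorem tendstoInMeasure_of_tendsto_whp {f : ℕ → Ω → ℝ} {y : ℝ}
    (h : Tendsto (fun z : ℕ × Ω => f z.1 z.2) (whp P) (𝓝 y)) :
    TendstoInMeasure P f atTop fun _ => y := by
  intro ε hε
  have := eventually_whp_iff.1 (h.eventually (Metric.eball_mem_nhds y hε))
  simpa using this

end WithHighProbability

/-! ### Dominated convergence for signed measures -/

/-- Dominated convergence along an arbitrary filter, for continuous convergence. -/
theorem tendsto_integral_abs_sub_of_dominated {ι X : Type*} [TopologicalSpace X]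
    [SigmaCompactSpace X] [T2Space X] [MeasurableSpace X] [BorelSpace X] {μ : Measure X}
    [IsFiniteMeasure μ] {L : Filter ι} {f : ι → X → ℝ} {g B : X → ℝ} (hB : Integrable B μ)
    (hg : Continuous g) (hgB : ∀ x, |g x| ≤ B x)
    (hfB : ∀ᶠ i in L, ∀ᵐ x ∂μ, |f i x| ≤ B x)
    (hlim : ∀ x, Tendsto (fun z : ι × X => f z.1 z.2) (L ×ˢ 𝓝 x) (𝓝 (g x))) :
    Tendsto (fun i => ∫ x, |f i x - g x| ∂μ) L (𝓝 0) := by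
  -- No countable basis of `L` is assumed, so the sequential theorem is replaced by uniform
  -- convergence on compact sets together with smallness of the integral of `B` off a large compact
  -- set.
  have hunif : ∀ K : Set X, IsCompact K → TendstoUniformlyOn f g L K := fun K hK => by
    rw [← tendstoLocallyUniformlyOn_iff_tendstoUniformlyOn_of_compact hK,
      tendstoLocallyUniformlyOn_iff_forall_tendsto]
    intro x _
    have h1 : Tendsto (fun z : ι × X => (g z.2, f z.1 z.2)) (L ×ˢ 𝓝 x) (𝓝 (g x, g x)) :=
      ((hg.tendsto x).comp tendsto_snd).prodMk_nhds (hlim x)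
    exact (h1.mono_right (nhds_le_uniformity _)).mono_left
      (Filter.prod_mono le_rfl nhdsWithin_le_nhds)
  have hanti : Antitone fun n => (compactCovering X n)ᶜ := fun m n hmn =>
    Set.compl_subset_compl.2 (compactCovering_subset X hmn)
  have hmeas : ∀ n, MeasurableSet (compactCovering X n)ᶜ := fun n =>
    (isCompact_compactCovering X n).measurableSet.compl
  have htail := tendsto_setIntegral_of_antitone (μ := μ) (f := B) hmeas hanti ⟨0, hB.integrableOn⟩
  rw [← Set.compl_iUnion, iUnion_compactCovering, Set.compl_univ, Measure.restrict_empty,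
    integral_zero_measure] at htail
  rw [tendsto_order]
  refine ⟨fun a ha => Eventually.of_forall fun i =>
    ha.trans_le (integral_nonneg fun x => abs_nonneg _), fun ε hε => ?_⟩
  obtain ⟨n, hn⟩ := (htail.eventually_lt_const (show 0 < ε / 4 by positivity)).exists
  set K := compactCovering X n
  -- The compact part costs less than `ε / 2`, the `+ 1` covering the zero measure; the tail costs
  -- `2 * (ε / 4)`.
  set δ := ε / (2 * (μ.real Set.univ + 1)) with hδ
  have hμ : 0 ≤ μ.real Set.univ := measureReal_nonneg
  have hδ0 : 0 < δ := by positivity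
  filter_upwards [hfB, Metric.tendstoUniformlyOn_iff.1
    (hunif K (isCompact_compactCovering X n)) δ hδ0] with i hi hi'
  have hint : Integrable (Kᶜ.indicator fun x => 2 * B x) μ :=
    (hB.const_mul 2).indicator (hmeas n)
  calc ∫ x, |f i x - g x| ∂μ ≤ ∫ x, (δ + Kᶜ.indicator (fun x => 2 * B x) x) ∂μ := by
        refine integral_mono_of_nonneg (Eventually.of_forall fun x => abs_nonneg _)
          ((integrable_const δ).add hint) ?_
        filter_upwards [hi] with x hx
        by_cases hxK : x ∈ K
        · have := hi' x hxK
          rw [Real.dist_eq, abs_sub_comm] at this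
          simpa [hxK] using this.le
        · have h1 := abs_sub (f i x) (g x)
          have h2 := hgB x
          simp only [Set.indicator_of_mem (show x ∈ Kᶜ from hxK)]
          linarith
    _ = δ * μ.real Set.univ + 2 * ∫ x in Kᶜ, B x ∂μ := by
        rw [integral_add (integrable_const δ) hint, integral_const,
          integral_indicator (hmeas n), integral_const_mul, smul_eq_mul, mul_comm]
    _ < ε := by
        have : δ * (μ.real Set.univ + 1) = ε / 2 := by rw [hδ]; field_simp
        nlinarith

theorem sigmaCompactSpace_Ioc (a b : ℝ) : SigmaCompactSpace (Set.Ioc a b) :=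
  have := (isLocallyClosed_Ioc (a := a) (b := b)).locallyCompactSpace
  sigmaCompactSpace_of_locallyCompact_secondCountable

theorem tendsto_integral_signedMeasure_of_dominated {ι X : Type*} [TopologicalSpace X]
    [SigmaCompactSpace X] [T2Space X] [TopologicalSpace.PseudoMetrizableSpace X] [SecondCountableTopology X]
    [MeasurableSpace X] [BorelSpace X] (ν : SignedMeasure X) {L : Filter ι}
    {f : ι → X → ℝ} {g B : X → ℝ} (hB : ν.Integrable B)
    (hg : Continuous g) (hgB : ∀ x, |g x| ≤ B x) (hf : ∀ i, Measurable (f i))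
    (hfB : ∀ᶠ i in L, ∀ᵐ x ∂ν.variation, |f i x| ≤ B x)
    (hlim : ∀ x, Tendsto (fun z : ι × X => f z.1 z.2) (L ×ˢ 𝓝 x) (𝓝 (g x))) :
    Tendsto (fun i => ∫ᵛ x, f i x ∂<•ν) L (𝓝 (∫ᵛ x, g x ∂<•ν)) := by
  have : IsFiniteMeasure ν.variation := by
    rw [← SignedMeasure.totalVariation_eq_variation]; infer_instance
  have h := tendsto_integral_abs_sub_of_dominated hB hg hgB hfB hlim
  have hgi : ν.Integrable g := Integrable.mono' hB hg.aestronglyMeasurable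
    (Eventually.of_forall hgB)
  rw [tendsto_iff_norm_sub_tendsto_zero]
  have h2 := h.const_mul ‖(ContinuousLinearMap.lsmul ℝ ℝ (E := ℝ)).flip‖
  rw [mul_zero] at h2
  refine tendsto_of_tendsto_of_tendsto_of_le_of_le' tendsto_const_nhds h2
    (Eventually.of_forall fun i => norm_nonneg _) ?_
  filter_upwards [hfB] with i hi
  have hfi : ν.Integrable (f i) := Integrable.mono' hB (hf i).aestronglyMeasurable hi
  rw [← VectorMeasure.integral_fun_sub hfi hgi]
  exact VectorMeasure.norm_integral_le_integral_norm

/-! ### Tail form of attraction and growth of the normalizing sequences -/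

/-- Taking logarithms gives `-n * log z → s`, hence `z → 1`; then `-z * log z ≤ 1 - z ≤ -log z`
squeezes. -/
theorem tendsto_nat_mul_one_sub {z : ℕ → ℝ} {s : ℝ} (hz0 : ∀ n, 0 ≤ z n)
    (h : Tendsto (fun n => z n ^ n) atTop (𝓝 (Real.exp (-s)))) :
    Tendsto (fun n : ℕ => (n : ℝ) * (1 - z n)) atTop (𝓝 s) := by
  have hpos : ∀ᶠ n in atTop, 0 < z n := by
    filter_upwards [h.eventually_const_lt (Real.exp_pos _), eventually_ne_atTop 0] with n hn hn0
    exact (hz0 n).lt_of_ne fun h0 => by rw [← h0, zero_pow hn0] at hn; exact lt_irrefl _ hn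
  have hlog : Tendsto (fun n : ℕ => (n : ℝ) * -Real.log (z n)) atTop (𝓝 s) := by
    have := (h.log (Real.exp_pos _).ne').neg
    rw [Real.log_exp, neg_neg] at this
    refine this.congr fun n => ?_
    rw [Real.log_pow]
    ring
  have hlog0 : Tendsto (fun n : ℕ => -Real.log (z n)) atTop (𝓝 0) := by
    have := hlog.mul tendsto_inv_atTop_nhds_zero_nat
    rw [mul_zero] at this
    refine this.congr' ?_
    filter_upwards [eventually_ne_atTop 0] with n hn
    field_simp
  have hz : Tendsto z atTop (𝓝 1) := by
    have := (Real.continuous_exp.tendsto _).comp hlog0.neg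
    rw [neg_zero, Real.exp_zero] at this
    refine this.congr' ?_
    filter_upwards [hpos] with n hn
    simp [Real.exp_log hn]
  have hlow := hlog.mul hz
  rw [mul_one] at hlow
  refine tendsto_of_tendsto_of_tendsto_of_le_of_le' hlow hlog ?_ ?_
  · filter_upwards [hpos] with n hn
    have h1 := Real.log_le_sub_one_of_pos (inv_pos.2 hn)
    rw [Real.log_inv] at h1
    rw [mul_assoc]
    gcongr
    calc -Real.log (z n) * z n ≤ ((z n)⁻¹ - 1) * z n := by gcongr
      _ = 1 - z n := by field_simp
  · filter_upwards [hpos] with n hn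
    have h1 := Real.log_le_sub_one_of_pos hn
    gcongr
    linarith

/-- The level which is exceeded with probability about `s / q`. -/
noncomputable def tailLevel (γ : ℝ) (a b : ℕ → ℝ) (q : ℕ) (s : ℝ) : ℝ :=
  a q * gevTailQuantile γ s + b q

/-- The tail form of attraction to `G_γ` with normalizing sequences `a` and `b`. -/
structure IsTailNormalization (μ : Measure ℝ) (γ : ℝ) (a b : ℕ → ℝ) : Prop where
  pos : ∀ n, 0 < a n
  tendsto_tail : ∀ s, 0 < s →
    Tendsto (fun n : ℕ => (n : ℝ) * μ.real (Set.Ioi (tailLevel γ a b n s))) atTop (𝓝 s)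

theorem InDomainOfAttraction.exists_isTailNormalization {μ : Measure ℝ} [IsProbabilityMeasure μ]
    {γ : ℝ} (h : InDomainOfAttraction (fun x => cdf μ x) γ) :
    ∃ a b, IsTailNormalization μ γ a b := by
  obtain ⟨a, b, ha, hab⟩ := h
  refine ⟨a, b, ha, fun s hs => ?_⟩
  have h1 := hab (gevTailQuantile γ s)
  rw [gevCDF_gevTailQuantile hs] at h1
  refine (tendsto_nat_mul_one_sub (fun n => cdf_nonneg μ _) h1).congr
    fun n => ?_
  rw [cdf_eq_real, ← Set.compl_Iic, probReal_compl_eq_one_sub measurableSet_Iic]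
  rfl

namespace IsTailNormalization

variable {μ : Measure ℝ} {γ : ℝ} {a b : ℕ → ℝ}

theorem tailLevel_lt (h : IsTailNormalization μ γ a b) (q : ℕ) {s t : ℝ} (hs : 0 < s)
    (hst : s < t) : tailLevel γ a b q t < tailLevel γ a b q s := by
  have := mul_lt_mul_of_pos_left (gevTailQuantile_lt (γ := γ) hs hst) (h.pos q)
  unfold tailLevel
  linarith

variable [IsProbabilityMeasure μ]

/-- Doubling the sample size halves the relative rank of a level. -/
theorem tendsto_tailLevel_two_mul (h : IsTailNormalization μ γ a b) {s : ℝ} (hs : 0 < s) :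
    Tendsto (fun n => (tailLevel γ a b (2 * n) s - b n) / a n) atTop
      (𝓝 (gevTailQuantile γ (s / 2))) := by
  have h2 : Tendsto (fun n : ℕ => 2 * n) atTop atTop :=
    tendsto_id.const_mul_atTop' two_pos
  have hT : Tendsto (fun n : ℕ => (n : ℝ) * μ.real (Set.Ioi (tailLevel γ a b (2 * n) s))) atTop
      (𝓝 (s / 2)) := by
    refine (((h.tendsto_tail s hs).comp h2).div_const 2).congr fun n => ?_
    simp only [Function.comp_apply, Nat.cast_mul, Nat.cast_ofNat]
    ring
  have hc := continuousAt_gevTailQuantile (γ := γ) (half_pos hs)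
  -- A strict inequality between tail probabilities reverses to one between levels, so no continuity
  -- of `μ` is needed. Below, the level is compared with levels of rank `t` slightly above or below
  -- `s / 2`.
  have hmono : ∀ (n : ℕ) (x y : ℝ), (n : ℝ) * μ.real (Set.Ioi x) < n * μ.real (Set.Ioi y) → y < x := by
    intro n x y hxy
    by_contra! hle
    exact hxy.not_ge (mul_le_mul_of_nonneg_left
      (measureReal_mono (Set.Ioi_subset_Ioi hle)) n.cast_nonneg)
  rw [tendsto_order]
  constructor
  · intro v hv
    have hev : ∀ᶠ t in 𝓝[>] (s / 2), v < gevTailQuantile γ t :=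
      (hc.eventually_const_lt hv).filter_mono nhdsWithin_le_nhds
    obtain ⟨t, ht, hts⟩ := (hev.and self_mem_nhdsWithin).exists
    have hts' : s / 2 < t := hts
    have ht0 : 0 < t := (half_pos hs).trans hts
    filter_upwards [hT.eventually_lt (h.tendsto_tail t ht0) hts'] with n hn
    have := hmono n _ _ hn
    refine ht.trans ?_
    rw [lt_div_iff₀ (h.pos n)]
    simp only [tailLevel] at this ⊢
    linarith
  · intro v hv
    have hev : ∀ᶠ t in 𝓝[<] (s / 2), gevTailQuantile γ t < v :=
      (hc.eventually_lt_const hv).filter_mono nhdsWithin_le_nhds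
    obtain ⟨t, ⟨ht, ht0⟩, hts⟩ := ((hev.and ((eventually_gt_nhds (half_pos hs)).filter_mono
      nhdsWithin_le_nhds)).and self_mem_nhdsWithin).exists
    have hts' : t < s / 2 := hts
    filter_upwards [(h.tendsto_tail t ht0).eventually_lt hT hts'] with n hn
    have := hmono n _ _ hn
    refine lt_of_le_of_lt ?_ ht
    rw [div_le_iff₀ (h.pos n)]
    simp only [tailLevel] at this ⊢
    linarith

theorem tendsto_shift_two_mul (h : IsTailNormalization μ γ a b) :
    Tendsto (fun n => (b (2 * n) - b n) / a n) atTop (𝓝 (gevTailQuantile γ (1 / 2))) := by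
  simpa [tailLevel] using h.tendsto_tailLevel_two_mul one_pos

/-- The levels of ranks `2` and `1` for sample size `2 * n` differ by `a (2 * n) * V 2`, and seen at
size `n` they have ranks `1` and `1 / 2`. The ratio of the limits is `-V (1 / 2) / V 2 = 2 ^ γ`. -/
theorem tendsto_scale_two_mul (h : IsTailNormalization μ γ a b) :
    Tendsto (fun n => a (2 * n) / a n) atTop (𝓝 (2 ^ γ)) := by
  have h0 : gevTailQuantile γ 2 < 0 := by
    simpa using gevTailQuantile_lt (γ := γ) one_pos one_lt_two
  have h0' := h0.ne
  have h1 := ((h.tendsto_tailLevel_two_mul two_pos).sub h.tendsto_shift_two_mul).div_const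
    (gevTailQuantile γ 2)
  rw [div_self two_ne_zero, gevTailQuantile_one, gevTailQuantile_half] at h1
  convert h1.congr fun n => ?_ using 2
  · field_simp
    ring
  · have := (h.pos n).ne'
    simp only [tailLevel]
    field_simp
    ring

theorem exists_scale_lower_bound (h : IsTailNormalization μ γ a b) :
    ∃ ρ : ℝ, 0 < ρ ∧ ρ < 1 ∧ ∀ᶠ q in atTop, ∀ r : ℕ, ρ ^ r * a q ≤ a (2 ^ r * q) := by
  obtain ⟨ρ, hρ0, hρ⟩ := exists_between (lt_min (Real.rpow_pos_of_pos two_pos γ) one_pos)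
  refine ⟨ρ, hρ0, hρ.trans_le (min_le_right _ _), ?_⟩
  obtain ⟨q₀, hq₀⟩ := eventually_atTop.1
    (h.tendsto_scale_two_mul.eventually_const_lt (hρ.trans_le (min_le_left _ _)))
  filter_upwards [eventually_ge_atTop q₀] with q hq r
  induction r with
  | zero => simp
  | succ r ih =>
    have h1 : q₀ ≤ 2 ^ r * q := hq.trans (Nat.le_mul_of_pos_left q (by positivity))
    have h2 := hq₀ _ h1
    rw [lt_div_iff₀ (h.pos _)] at h2
    calc ρ ^ (r + 1) * a q = ρ * (ρ ^ r * a q) := by ring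
      _ ≤ ρ * a (2 ^ r * q) := by gcongr
      _ ≤ a (2 * (2 ^ r * q)) := h2.le
      _ = a (2 ^ (r + 1) * q) := by rw [← mul_assoc, ← pow_succ']

/-- Iterated doubling with any `ρ` above `2 ^ γ`. As `γ < 1`, there is room for `ρ < 2`, so the
scale grows more slowly than the tail probabilities decay. -/
theorem exists_scale_upper_bound (h : IsTailNormalization μ γ a b) (hγ : γ < 1) :
    ∃ ρ : ℝ, 0 < ρ ∧ ρ < 2 ∧ ∀ᶠ q in atTop, ∀ r : ℕ, a (2 ^ r * q) ≤ ρ ^ r * a q := by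
  have h2 : (2 : ℝ) ^ γ < 2 := by
    simpa using Real.rpow_lt_rpow_of_exponent_lt one_lt_two hγ
  obtain ⟨ρ, hρ0, hρ⟩ := exists_between h2
  have hρpos : 0 < ρ := (Real.rpow_pos_of_pos two_pos γ).trans hρ0
  refine ⟨ρ, hρpos, hρ, ?_⟩
  obtain ⟨q₀, hq₀⟩ := eventually_atTop.1 (h.tendsto_scale_two_mul.eventually_lt_const hρ0)
  filter_upwards [eventually_ge_atTop q₀] with q hq r
  induction r with
  | zero => simp
  | succ r ih =>
    have h1 : q₀ ≤ 2 ^ r * q := hq.trans (Nat.le_mul_of_pos_left q (by positivity))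
    have h2 := hq₀ _ h1
    rw [div_lt_iff₀ (h.pos _)] at h2
    calc a (2 ^ (r + 1) * q) = a (2 * (2 ^ r * q)) := by rw [← mul_assoc, ← pow_succ']
      _ ≤ ρ * a (2 ^ r * q) := h2.le
      _ ≤ ρ * (ρ ^ r * a q) := by gcongr
      _ = ρ ^ (r + 1) * a q := by ring

end IsTailNormalization

/-! ### First moment bound for the excess over a high level -/

/-- Telescoping up to the first `N` with `x ≤ v N`: all earlier levels lie below `x`. The levels
need not be monotone, since `ENNReal.ofReal` discards negative steps. -/
theorem ofReal_sub_le_tsum_indicator {v : ℕ → ℝ} {x : ℝ} (hx : ∃ N, x ≤ v N) :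
    ENNReal.ofReal (max (x - v 0) 0) ≤
      ∑' r, (Set.Ioi (v r)).indicator (fun _ => ENNReal.ofReal (v (r + 1) - v r)) x := by
  classical
  have hN := Nat.find_spec hx
  set N := Nat.find hx
  have hlt : ∀ r < N, v r < x := fun r hr => not_le.1 (Nat.find_min hx hr)
  have hmax : max (x - v 0) 0 ≤ ∑ r ∈ Finset.range N, max (v (r + 1) - v r) 0 := by
    refine max_le ?_ (Finset.sum_nonneg fun r _ => le_max_right _ _)
    calc x - v 0 ≤ v N - v 0 := by linarith
      _ = ∑ r ∈ Finset.range N, (v (r + 1) - v r) := (Finset.sum_range_sub v N).symm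
      _ ≤ _ := Finset.sum_le_sum fun r _ => le_max_left _ _
  calc ENNReal.ofReal (max (x - v 0) 0)
      ≤ ENNReal.ofReal (∑ r ∈ Finset.range N, max (v (r + 1) - v r) 0) :=
        ENNReal.ofReal_le_ofReal hmax
    _ = ∑ r ∈ Finset.range N,
          (Set.Ioi (v r)).indicator (fun _ => ENNReal.ofReal (v (r + 1) - v r)) x := by
        rw [ENNReal.ofReal_sum_of_nonneg fun r _ => le_max_right _ _]
        refine Finset.sum_congr rfl fun r hr => ?_
        rw [Set.indicator_of_mem (show x ∈ Set.Ioi (v r) from hlt r (Finset.mem_range.1 hr))]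
        rcases le_total (v (r + 1) - v r) 0 with h | h
        · rw [max_eq_right h, ENNReal.ofReal_of_nonpos h, ENNReal.ofReal_zero]
        · rw [max_eq_left h]
    _ ≤ _ := ENNReal.sum_le_tsum _

theorem lintegral_excess_le_tsum {μ : Measure ℝ} {v : ℕ → ℝ}
    (hv : Tendsto (fun r => μ (Set.Ioi (v r))) atTop (𝓝 0)) :
    ∫⁻ x, ENNReal.ofReal (max (x - v 0) 0) ∂μ ≤
      ∑' r, ENNReal.ofReal (v (r + 1) - v r) * μ (Set.Ioi (v r)) := by
  have hae : ∀ᵐ x ∂μ, ∃ N, x ≤ v N := by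
    rw [ae_iff]
    refine le_antisymm (ge_of_tendsto' hv fun r => measure_mono fun x hx => ?_) zero_le
    simp only [Set.mem_ofPred_eq, not_exists, not_le] at hx
    exact hx r
  calc _ ≤ ∫⁻ x, ∑' r, (Set.Ioi (v r)).indicator
          (fun _ => ENNReal.ofReal (v (r + 1) - v r)) x ∂μ :=
        lintegral_mono_ae (hae.mono fun x hx => ofReal_sub_le_tsum_indicator hx)
    _ = _ := by
        rw [lintegral_tsum fun r => (measurable_const.indicator measurableSet_Ioi).aemeasurable]
        refine tsum_congr fun r => ?_
        rw [lintegral_indicator_const measurableSet_Ioi]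

namespace IsTailNormalization

variable {μ : Measure ℝ} [IsProbabilityMeasure μ] {γ : ℝ} {a b : ℕ → ℝ}

theorem exists_lintegral_excess_le (h : IsTailNormalization μ γ a b) (hγ : γ < 1) :
    ∃ C θ : ℝ, 0 < C ∧ 0 < θ ∧ θ < 1 ∧ ∀ᶠ q : ℕ in atTop, ∀ R : ℕ,
      ∫⁻ x, ENNReal.ofReal (max (x - b (2 ^ R * q)) 0) ∂μ ≤
        ENNReal.ofReal (C * θ ^ R * a q / q) := by
  obtain ⟨ρ, hρ0, hρ2, hρ⟩ := h.exists_scale_upper_bound hγ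
  set D := gevTailQuantile γ (1 / 2) + 1 with hD
  have hD0 : 0 < D := by
    have := gevTailQuantile_pos (γ := γ) one_half_pos one_half_lt_one
    linarith
  have hshift := h.tendsto_shift_two_mul.eventually_lt_const (show _ < D by linarith)
  have htail := (h.tendsto_tail 1 one_pos).eventually_lt_const one_lt_two
  obtain ⟨q₀, hq₀⟩ := eventually_atTop.1 (hshift.and htail)
  set θ := ρ / 2 with hθ
  have hθ0 : 0 < θ := by positivity
  have hθ1 : θ < 1 := by rw [hθ]; linarith
  -- With levels `b (2 ^ (R + r) * q)`, a step is at most `D * ρ ^ (R + r) * a q` and the tail at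
  -- most `2 / (2 ^ (R + r) * q)`. The products form a geometric series of ratio `θ = ρ / 2`.
  refine ⟨2 * D / (1 - θ), θ, div_pos (by positivity) (by linarith), hθ0, hθ1, ?_⟩
  filter_upwards [hρ, eventually_ge_atTop q₀, eventually_gt_atTop 0] with q hq hqq₀ hqpos R
  have hqpos' : (0 : ℝ) < q := by exact_mod_cast hqpos
  set v : ℕ → ℝ := fun r => b (2 ^ (R + r) * q) with hv
  have hvstep : ∀ r, v (r + 1) - v r ≤ D * (ρ ^ (R + r) * a q) := fun r => by
    have h1 := (hq₀ (2 ^ (R + r) * q)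
      (hqq₀.trans (Nat.le_mul_of_pos_left q (by positivity)))).1
    rw [div_lt_iff₀ (h.pos _), ← mul_assoc, ← pow_succ'] at h1
    refine h1.le.trans ?_
    gcongr
    exact hq _
  have hvtail : ∀ r, μ (Set.Ioi (v r)) ≤ ENNReal.ofReal (2 / (2 ^ (R + r) * q)) := fun r => by
    have h1 := (hq₀ (2 ^ (R + r) * q)
      (hqq₀.trans (Nat.le_mul_of_pos_left q (by positivity)))).2
    simp only [tailLevel, gevTailQuantile_one, mul_zero, zero_add] at h1
    push_cast at h1
    rw [← ofReal_measureReal]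
    refine ENNReal.ofReal_le_ofReal ?_
    rw [le_div_iff₀ (by positivity), mul_comm]
    exact h1.le
  have hvlim : Tendsto (fun r => μ (Set.Ioi (v r))) atTop (𝓝 0) := by
    suffices hlim : Tendsto (fun r : ℕ => 2 / (2 ^ (R + r) * (q : ℝ))) atTop (𝓝 0) by
      have := ENNReal.tendsto_ofReal hlim
      rw [ENNReal.ofReal_zero] at this
      exact tendsto_of_tendsto_of_tendsto_of_le_of_le tendsto_const_nhds this
        (fun _ => zero_le) hvtail
    have := (tendsto_pow_atTop_nhds_zero_of_lt_one (r := (1 / 2 : ℝ)) (by norm_num)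
      (by norm_num)).const_mul (2 / (2 ^ R * (q : ℝ)))
    rw [mul_zero] at this
    refine this.congr fun r => ?_
    rw [pow_add, div_pow, one_pow]
    field_simp
  have hsum : Summable fun r : ℕ => 2 * D * θ ^ R * a q / q * θ ^ r :=
    (summable_geometric_of_lt_one hθ0.le hθ1).mul_left _
  have ha := h.pos q
  calc _ ≤ ∑' r, ENNReal.ofReal (v (r + 1) - v r) * μ (Set.Ioi (v r)) := by
        simpa [hv] using lintegral_excess_le_tsum hvlim
    _ ≤ ∑' r, ENNReal.ofReal (2 * D * θ ^ R * a q / q * θ ^ r) := by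
        refine ENNReal.tsum_le_tsum fun r => ?_
        refine (mul_le_mul' (ENNReal.ofReal_le_ofReal (hvstep r)) (hvtail r)).trans ?_
        rw [← ENNReal.ofReal_mul (by positivity)]
        refine ENNReal.ofReal_le_ofReal (le_of_eq ?_)
        rw [hθ, div_pow, div_pow, pow_add, pow_add]
        field_simp
    _ = _ := by
        rw [← ENNReal.ofReal_tsum_of_nonneg (fun r => by positivity) hsum, tsum_mul_left,
          tsum_geometric_of_lt_one hθ0.le hθ1]
        congr 1
        have : 1 - θ ≠ 0 := by linarith
        field_simp

end IsTailNormalization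

/-! ### Moment and union bounds for independent samples -/

section IIDSample

variable {Ω : Type*} [MeasurableSpace Ω] {P : Measure Ω} {X : ℕ → Ω → ℝ} {μ : Measure ℝ}

/-- Chebyshev's inequality; the variance of a sum of independent indicators is at most its mean. -/
theorem measure_le_abs_exceedCount_sub_le [IsProbabilityMeasure P]
    (hX : ∀ i, HasLaw (X i) μ P) (hindep : iIndepFun X P) (n : ℕ) (u : ℝ) {ε : ℝ} (hε : 0 < ε) :
    P {ω | ε ≤ |(exceedCount (fun i => X i ω) n u : ℝ) - n * μ.real (Set.Ioi u)|} ≤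
      ENNReal.ofReal (n * μ.real (Set.Ioi u) / ε ^ 2) := by
  set g : ℝ → ℝ := (Set.Ioi u).indicator 1 with hg
  have hgm : Measurable g := measurable_one.indicator measurableSet_Ioi
  set Y : ℕ → Ω → ℝ := fun i => g ∘ X i with hY
  have hYm : ∀ i, AEStronglyMeasurable (Y i) P := fun i =>
    (hgm.comp_aemeasurable (hX i).aemeasurable).aestronglyMeasurable
  have hYL : ∀ i, MemLp (Y i) 2 P := fun i => by
    refine MemLp.of_bound (hYm i) 1 (Eventually.of_forall fun ω => ?_)
    simp only [hY, hg, Function.comp_apply, Set.indicator_apply]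
    split_ifs <;> simp
  have hEY : ∀ i, ∫ ω, Y i ω ∂P = μ.real (Set.Ioi u) := fun i => by
    rw [hY, (hX i).integral_comp hgm.aestronglyMeasurable, hg,
      integral_indicator_one measurableSet_Ioi]
  have hVar : ∀ i, variance (Y i) P ≤ μ.real (Set.Ioi u) := fun i => by
    refine (variance_le_expectation_sq (hYm i)).trans (le_of_eq ?_)
    rw [← hEY i]
    refine integral_congr_ae (Eventually.of_forall fun ω => ?_)
    simp only [hY, hg, Pi.pow_apply, Function.comp_apply, Set.indicator_apply]
    split_ifs <;> simp
  have hind := hindep.comp (fun _ => g) fun _ => hgm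
  have hsum : ∀ ω, (∑ i ∈ Finset.range n, Y i) ω = exceedCount (fun i => X i ω) n u := fun ω => by
    rw [Finset.sum_apply, exceedCount, Finset.card_filter]
    push_cast
    refine Finset.sum_congr rfl fun i _ => ?_
    simp [hY, hg, Set.indicator_apply]
  have hE : ∫ ω, (∑ i ∈ Finset.range n, Y i) ω ∂P = n * μ.real (Set.Ioi u) := by
    simp_rw [Finset.sum_apply]
    rw [integral_finsetSum _ fun i _ => (hYL i).integrable (by norm_num)]
    simp [hEY]
  have hV : variance (∑ i ∈ Finset.range n, Y i) P ≤ n * μ.real (Set.Ioi u) := by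
    rw [IndepFun.variance_sum (fun i _ => hYL i) fun i _ j _ hij => hind.indepFun hij]
    refine (Finset.sum_le_sum fun i _ => hVar i).trans (by simp)
  have h := meas_ge_le_variance_div_sq (memLp_finsetSum' _ fun i _ => hYL i) hε
    (X := ∑ i ∈ Finset.range n, Y i) (μ := P)
  rw [hE] at h
  simp_rw [hsum] at h
  exact h.trans (ENNReal.ofReal_le_ofReal (by gcongr))

theorem measure_le_totalExcess_le (hX : ∀ i, HasLaw (X i) μ P) (n : ℕ) (u : ℝ) {ε : ℝ}
    (hε : 0 < ε) :
    P {ω | ε ≤ totalExcess (fun i => X i ω) n u} ≤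
      n * (∫⁻ x, ENNReal.ofReal (max (x - u) 0) ∂μ) / ENNReal.ofReal ε := by
  have hgm : Measurable fun x : ℝ => ENNReal.ofReal (max (x - u) 0) := by fun_prop
  have hm : AEMeasurable
      (fun ω => ENNReal.ofReal (totalExcess (fun i => X i ω) n u)) P := by
    refine ENNReal.measurable_ofReal.comp_aemeasurable ?_
    refine Finset.aemeasurable_fun_sum _ fun i _ => ?_
    exact ((hX i).aemeasurable.sub_const u).max aemeasurable_const
  have h := meas_ge_le_lintegral_div hm (ε := ENNReal.ofReal ε) (by simpa using hε)
    ENNReal.ofReal_ne_top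
  refine (measure_mono fun ω hω => ENNReal.ofReal_le_ofReal hω).trans (h.trans_eq ?_)
  congr 1
  calc _ = ∫⁻ ω, ∑ i ∈ Finset.range n, ENNReal.ofReal (max (X i ω - u) 0) ∂P :=
        lintegral_congr fun ω => ENNReal.ofReal_sum_of_nonneg fun i _ => le_max_right _ _
    _ = ∑ i ∈ Finset.range n, ∫⁻ ω, ENNReal.ofReal (max (X i ω - u) 0) ∂P :=
        lintegral_finsetSum' _ fun i _ => hgm.comp_aemeasurable (hX i).aemeasurable
    _ = _ := by
        simp_rw [fun i => (hX i).lintegral_comp (f := fun x => ENNReal.ofReal (max (x - u) 0))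
          hgm.aemeasurable]
        simp

theorem measure_exists_pair_mem_le [IsFiniteMeasure μ] (hX : ∀ i, HasLaw (X i) μ P)
    (hindep : iIndepFun X P) (n : ℕ) {S : Set ℝ} (hS : MeasurableSet S) :
    P {ω | ∃ i < n, ∃ j < n, i ≠ j ∧ X i ω ∈ S ∧ X j ω ∈ S} ≤
      ENNReal.ofReal ((n * μ.real S) ^ 2) := by
  have hpair : ∀ i j, i ≠ j → P {ω | X i ω ∈ S ∧ X j ω ∈ S} = μ S * μ S := fun i j hij => by
    have h := (hindep.indepFun hij).measure_inter_preimage_eq_mul S S hS hS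
    have hm : ∀ i, P (X i ⁻¹' S) = μ S := fun i => (hX i).measure_eq hS
    rw [hm, hm] at h
    exact h
  calc _ ≤ P (⋃ q ∈ (Finset.range n ×ˢ Finset.range n).filter fun q => q.1 ≠ q.2,
          {ω | X q.1 ω ∈ S ∧ X q.2 ω ∈ S}) := by
        refine measure_mono ?_
        rintro ω ⟨i, hi, j, hj, hij, h⟩
        simp only [Set.mem_iUnion]
        exact ⟨(i, j), by simp [hi, hj, hij], h⟩
    _ ≤ ∑ q ∈ (Finset.range n ×ˢ Finset.range n).filter fun q => q.1 ≠ q.2,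
          P {ω | X q.1 ω ∈ S ∧ X q.2 ω ∈ S} := measure_biUnion_finset_le _ _
    _ = ∑ q ∈ (Finset.range n ×ˢ Finset.range n).filter fun q => q.1 ≠ q.2, μ S * μ S :=
        Finset.sum_congr rfl fun q hq => hpair _ _ (Finset.mem_filter.1 hq).2
    _ ≤ ∑ q ∈ Finset.range n ×ˢ Finset.range n, μ S * μ S :=
        Finset.sum_le_sum_of_subset (Finset.filter_subset _ _)
    _ = _ := by
        rw [Finset.sum_const, Finset.card_product, Finset.card_range, nsmul_eq_mul,
          ENNReal.ofReal_pow (by positivity), ENNReal.ofReal_mul (by positivity),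
          ofReal_measureReal, ENNReal.ofReal_natCast]
        push_cast
        ring

end IIDSample

/-! ### Intermediate sequences -/

section Intermediate

variable {m : ℕ → ℕ}

theorem IsIntermediate.tendsto_ratio (hm : IsIntermediate m) :
    Tendsto (fun n : ℕ => (n : ℝ) / m n) atTop atTop := by
  have hpos : ∀ᶠ n : ℕ in atTop, 0 < (m n : ℝ) / n := by
    filter_upwards [hm.1.eventually_gt_atTop 0, eventually_gt_atTop 0] with n h1 h2
    positivity
  refine (Tendsto.inv_tendsto_nhdsGT_zero
    (tendsto_nhdsWithin_iff.2 ⟨hm.2, hpos⟩)).congr fun n => ?_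
  simp

theorem IsIntermediate.tendsto_div (hm : IsIntermediate m) :
    Tendsto (fun n : ℕ => n / m n) atTop atTop := by
  rw [← tendsto_natCast_atTop_iff (R := ℝ)]
  refine tendsto_atTop_mono (fun n => ?_) (tendsto_atTop_add_const_right _ (-1) hm.tendsto_ratio)
  have := Nat.lt_floor_add_one ((n : ℝ) / m n)
  rw [Nat.floor_div_eq_div] at this
  linarith

/-- The normalizing sequences have integer indices, so `n / m n` must be rounded down; this shows
that the rounding is harmless. -/
theorem IsIntermediate.tendsto_div_mul (hm : IsIntermediate m) :
    Tendsto (fun n : ℕ => (n : ℝ) / ((n / m n : ℕ) * m n)) atTop (𝓝 1) := by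
  have h1 : Tendsto (fun n : ℕ => 1 - (m n : ℝ) / n) atTop (𝓝 1) := by
    simpa using hm.2.const_sub 1
  have h2 : Tendsto (fun n : ℕ => ((n / m n : ℕ) * m n : ℝ) / n) atTop (𝓝 1) := by
    refine tendsto_of_tendsto_of_tendsto_of_le_of_le' h1 tendsto_const_nhds ?_ ?_
    · filter_upwards [eventually_gt_atTop 0, hm.1.eventually_gt_atTop 0] with n hn hmn
      have hn' : (0 : ℝ) < n := by exact_mod_cast hn
      rw [one_sub_div hn'.ne']
      gcongr
      have : n < n / m n * m n + m n := by
        have h1 := Nat.div_add_mod' n (m n)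
        have h2 := Nat.mod_lt n hmn
        omega
      have : (n : ℝ) < (n / m n : ℕ) * m n + m n := by exact_mod_cast this
      linarith
    · filter_upwards [eventually_gt_atTop 0] with n hn
      have hn' : (0 : ℝ) < n := by exact_mod_cast hn
      rw [div_le_one hn']
      exact_mod_cast Nat.div_mul_le_self n (m n)
  simpa using h2.inv₀ one_ne_zero

theorem IsIntermediate.eventually_lt (hm : IsIntermediate m) : ∀ᶠ n in atTop, m n < n := by
  filter_upwards [hm.2.eventually_lt_const one_pos, eventually_gt_atTop 0] with n hn hn0
  have hn' : (0 : ℝ) < n := by exact_mod_cast hn0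
  rw [div_lt_one hn'] at hn
  exact_mod_cast hn

theorem IsIntermediate.tendsto_cast (hm : IsIntermediate m) :
    Tendsto (fun n => (m n : ℝ)) atTop atTop :=
  tendsto_natCast_atTop_atTop.comp hm.1

end Intermediate

/-! ### Laws of large numbers for exceedance counts and total excesses -/

/-- A sample attracted to `G_γ`, with an intermediate sequence. -/
structure IsAttractedSample {Ω : Type*} [MeasurableSpace Ω] (P : Measure Ω) (X : ℕ → Ω → ℝ)
    (μ : Measure ℝ) (γ : ℝ) (a b : ℕ → ℝ) (m : ℕ → ℕ) : Prop where
  hasLaw : ∀ i, HasLaw (X i) μ P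
  indep : iIndepFun X P
  tail : IsTailNormalization μ γ a b
  inter : IsIntermediate m

/-- The number of exceedances of the level of relative rank `s`, relative to `m`. -/
noncomputable def relExceedCount {Ω : Type*} (X : ℕ → Ω → ℝ) (γ : ℝ) (a b : ℕ → ℝ) (m : ℕ → ℕ)
    (s : ℝ) (z : ℕ × Ω) : ℝ :=
  exceedCount (fun i => X i z.2) z.1 (tailLevel γ a b (z.1 / m z.1) s) / m z.1

/-- The normalized total excess over the level of relative rank `s`. -/
noncomputable def relExcess {Ω : Type*} (X : ℕ → Ω → ℝ) (γ : ℝ) (a b : ℕ → ℝ) (m : ℕ → ℕ)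
    (s : ℝ) (z : ℕ × Ω) : ℝ :=
  totalExcess (fun i => X i z.2) z.1 (tailLevel γ a b (z.1 / m z.1) s) /
    (m z.1 * a (z.1 / m z.1))

namespace IsAttractedSample

variable {Ω : Type*} [MeasurableSpace Ω] {P : Measure Ω} {X : ℕ → Ω → ℝ}
  {μ : Measure ℝ} {γ : ℝ} {a b : ℕ → ℝ} {m : ℕ → ℕ}

theorem relExcess_sub_le (h : IsAttractedSample P X μ γ a b m) (s t : ℝ) {z : ℕ × Ω}
    (hz : 0 < m z.1) :
    relExcess X γ a b m s z - relExcess X γ a b m t z ≤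
      relExceedCount X γ a b m s z * (gevTailQuantile γ t - gevTailQuantile γ s) := by
  have hz' : (0 : ℝ) < m z.1 := by exact_mod_cast hz
  have ha := h.tail.pos (z.1 / m z.1)
  have h1 := totalExcess_sub_le (x := fun i => X i z.2) (n := z.1)
    (tailLevel γ a b (z.1 / m z.1) s) (tailLevel γ a b (z.1 / m z.1) t)
  rw [relExcess, relExcess, relExceedCount, ← sub_div, div_le_iff₀ (by positivity)]
  refine h1.trans_eq ?_
  simp only [tailLevel]
  field_simp
  ring

theorem le_relExcess_sub (h : IsAttractedSample P X μ γ a b m) {s t : ℝ} (ht : 0 < t)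
    (hts : t < s) {z : ℕ × Ω} (hz : 0 < m z.1) :
    relExceedCount X γ a b m t z * (gevTailQuantile γ t - gevTailQuantile γ s) ≤
      relExcess X γ a b m s z - relExcess X γ a b m t z := by
  have hz' : (0 : ℝ) < m z.1 := by exact_mod_cast hz
  have ha := h.tail.pos (z.1 / m z.1)
  have h1 := le_totalExcess_sub (x := fun i => X i z.2) (n := z.1)
    (h.tail.tailLevel_lt (z.1 / m z.1) ht hts).le
  rw [relExcess, relExcess, relExceedCount, ← sub_div, le_div_iff₀ (by positivity)]
  refine le_trans (le_of_eq ?_) h1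
  simp only [tailLevel]
  field_simp
  ring

variable [IsProbabilityMeasure P]

/-- The mean tends to `s` by the tail form at `q = n / m n`, and Chebyshev bounds the fluctuation
probability by a quantity of order `1 / m n`. -/
theorem tendsto_relExceedCount (h : IsAttractedSample P X μ γ a b m) {s : ℝ} (hs : 0 < s) :
    Tendsto (relExceedCount X γ a b m s) (whp P) (𝓝 s) := by
  set T : ℕ → ℝ := fun n => μ.real (Set.Ioi (tailLevel γ a b (n / m n) s)) with hT
  have hmean : Tendsto (fun n : ℕ => n * T n / m n) atTop (𝓝 s) := by
    have h1 := ((h.tail.tendsto_tail s hs).comp h.inter.tendsto_div).mul h.inter.tendsto_div_mul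
    rw [mul_one] at h1
    refine h1.congr' ?_
    filter_upwards [h.inter.tendsto_div.eventually_gt_atTop 0] with n hn
    have : (0 : ℝ) < (n / m n : ℕ) := by exact_mod_cast hn
    simp only [Function.comp_apply, hT]
    field_simp
  have hfluct : Tendsto (fun z : ℕ × Ω => relExceedCount X γ a b m s z - z.1 * T z.1 / m z.1)
      (whp P) (𝓝 0) := by
    rw [Metric.tendsto_nhds]
    intro ε hε
    have hlim : Tendsto (fun n : ℕ => n * T n / m n * (1 / ε ^ 2) * (m n : ℝ)⁻¹) atTop (𝓝 0) := by
      have := (hmean.mul_const (1 / ε ^ 2)).mul h.inter.tendsto_cast.inv_tendsto_atTop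
      rwa [mul_zero] at this
    refine eventually_whp_of_le hlim ?_
    filter_upwards [h.inter.1.eventually_gt_atTop 0] with n hn
    have hn' : (0 : ℝ) < m n := by exact_mod_cast hn
    refine le_trans (measure_mono fun ω hω => ?_)
      ((measure_le_abs_exceedCount_sub_le h.hasLaw h.indep n (tailLevel γ a b (n / m n) s)
        (ε := ε * m n) (by positivity)).trans_eq ?_)
    · have h2 : ε ≤ dist (relExceedCount X γ a b m s (n, ω) - n * T n / m n) 0 := not_lt.1 hω
      rw [dist_zero_right, Real.norm_eq_abs, relExceedCount, ← sub_div, abs_div,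
        abs_of_pos hn', le_div_iff₀ hn'] at h2
      exact h2
    · congr 1
      field_simp
      rfl
  have := hfluct.add (hmean.comp tendsto_fst_whp)
  rw [zero_add] at this
  exact this.congr fun z => by simp

/-- Between neighbouring levels the excess changes by the level difference times a count taken at
one end or the other. On a finite grid the counts converge, and the resulting Riemann sums differ
from the increment of `A` by at most the mesh times `V t - V s`. -/
theorem tendsto_relExcess_sub (h : IsAttractedSample P X μ γ a b m) (hγ : γ < 1) {t s : ℝ}
    (ht : 0 < t) (hts : t < s) :
    Tendsto (fun z => relExcess X γ a b m s z - relExcess X γ a b m t z) (whp P)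
      (𝓝 (gevExcess γ s - gevExcess γ t)) := by
  set V := gevTailQuantile γ with hV
  have hmpos : ∀ᶠ z : ℕ × Ω in whp P, 0 < m z.1 :=
    eventually_whp_fst (h.inter.1.eventually_gt_atTop 0)
  have hmesh : Tendsto (fun J : ℕ => (s - t) / (J + 1) * (V t - V s)) atTop (𝓝 0) := by
    have := ((tendsto_one_div_add_atTop_nhds_zero_nat (𝕜 := ℝ)).const_mul (s - t)).mul_const
      (V t - V s)
    rw [mul_zero, zero_mul] at this
    exact this.congr fun J => by ring
  have hgrid : ∀ J : ℕ, ∃ r : ℕ → ℝ, r 0 = s ∧ r (J + 1) = t ∧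
      ∀ j < J + 1, 0 < r (j + 1) ∧ r (j + 1) < r j ∧ r j - r (j + 1) = (s - t) / (J + 1) := by
    intro J
    have hJ : (0 : ℝ) < J + 1 := by positivity
    have hd : 0 < (s - t) / (J + 1) := div_pos (by linarith) hJ
    refine ⟨fun j => s - j * ((s - t) / (J + 1)), by simp, ?_, fun j hj => ⟨?_, ?_, ?_⟩⟩
    · push_cast
      field_simp
      ring
    · have : ((j + 1 : ℕ) : ℝ) ≤ J + 1 := by exact_mod_cast hj
      have h2 : ((j + 1 : ℕ) : ℝ) * ((s - t) / (J + 1)) ≤ (J + 1) * ((s - t) / (J + 1)) := by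
        gcongr
      rw [mul_div_cancel₀ _ hJ.ne'] at h2
      simp only
      linarith
    · push_cast
      linarith
    · push_cast
      ring
  rw [tendsto_order]
  constructor
  · intro y hy
    obtain ⟨J, hJ⟩ := (hmesh.eventually_lt_const (sub_pos.2 hy)).exists
    obtain ⟨r, hr0, hrJ, hr⟩ := hgrid J
    have hlim : Tendsto (fun z => ∑ j ∈ Finset.range (J + 1),
        relExceedCount X γ a b m (r (j + 1)) z * (V (r (j + 1)) - V (r j))) (whp P)
        (𝓝 (∑ j ∈ Finset.range (J + 1), r (j + 1) * (V (r (j + 1)) - V (r j)))) :=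
      tendsto_finsetSum _ fun j hj =>
        (h.tendsto_relExceedCount (hr j (Finset.mem_range.1 hj)).1).mul_const _
    have hbound : y < ∑ j ∈ Finset.range (J + 1), r (j + 1) * (V (r (j + 1)) - V (r j)) := by
      calc y < gevExcess γ s - gevExcess γ t - (s - t) / (J + 1) * (V t - V s) := by linarith
        _ = ∑ j ∈ Finset.range (J + 1), ((gevExcess γ (r j) - gevExcess γ (r (j + 1))) -
              (s - t) / (J + 1) * (V (r (j + 1)) - V (r j))) := by
            rw [Finset.sum_sub_distrib, Finset.sum_range_sub' (fun j => gevExcess γ (r j)),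
              ← Finset.mul_sum, Finset.sum_range_sub (fun j => V (r j)), hr0, hrJ]
        _ ≤ _ := by
            refine Finset.sum_le_sum fun j hj => ?_
            obtain ⟨h1, h2, h3⟩ := hr j (Finset.mem_range.1 hj)
            have := gevExcess_sub_le hγ h1 h2.le
            rw [← h3]
            linarith
    filter_upwards [hlim.eventually_const_lt hbound, hmpos] with z hz hmz
    refine hz.trans_le ?_
    calc _ ≤ ∑ j ∈ Finset.range (J + 1), (relExcess X γ a b m (r j) z -
            relExcess X γ a b m (r (j + 1)) z) := Finset.sum_le_sum fun j hj => by
          obtain ⟨h1, h2, _⟩ := hr j (Finset.mem_range.1 hj)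
          exact h.le_relExcess_sub h1 h2 hmz
      _ = _ := by
          rw [Finset.sum_range_sub' (fun j => relExcess X γ a b m (r j) z), hr0, hrJ]
  · intro y hy
    obtain ⟨J, hJ⟩ := (hmesh.eventually_lt_const (sub_pos.2 hy)).exists
    obtain ⟨r, hr0, hrJ, hr⟩ := hgrid J
    have hlim : Tendsto (fun z => ∑ j ∈ Finset.range (J + 1),
        relExceedCount X γ a b m (r j) z * (V (r (j + 1)) - V (r j))) (whp P)
        (𝓝 (∑ j ∈ Finset.range (J + 1), r j * (V (r (j + 1)) - V (r j)))) :=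
      tendsto_finsetSum _ fun j hj => by
        obtain ⟨h1, h2, _⟩ := hr j (Finset.mem_range.1 hj)
        exact (h.tendsto_relExceedCount (h1.trans h2)).mul_const _
    have hbound : ∑ j ∈ Finset.range (J + 1), r j * (V (r (j + 1)) - V (r j)) < y := by
      calc _ ≤ ∑ j ∈ Finset.range (J + 1), ((gevExcess γ (r j) - gevExcess γ (r (j + 1))) +
              (s - t) / (J + 1) * (V (r (j + 1)) - V (r j))) := by
            refine Finset.sum_le_sum fun j hj => ?_
            obtain ⟨h1, h2, h3⟩ := hr j (Finset.mem_range.1 hj)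
            have := le_gevExcess_sub hγ h1 h2.le
            rw [← h3]
            linarith
        _ = gevExcess γ s - gevExcess γ t + (s - t) / (J + 1) * (V t - V s) := by
            rw [Finset.sum_add_distrib, Finset.sum_range_sub' (fun j => gevExcess γ (r j)),
              ← Finset.mul_sum, Finset.sum_range_sub (fun j => V (r j)), hr0, hrJ]
        _ < y := by linarith
    filter_upwards [hlim.eventually_lt_const hbound, hmpos] with z hz hmz
    refine lt_of_le_of_lt ?_ hz
    calc _ = ∑ j ∈ Finset.range (J + 1), (relExcess X γ a b m (r j) z -
            relExcess X γ a b m (r (j + 1)) z) := by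
          rw [Finset.sum_range_sub' (fun j => relExcess X γ a b m (r j) z), hr0, hrJ]
      _ ≤ _ := Finset.sum_le_sum fun j hj => h.relExcess_sub_le _ _ hmz

end IsAttractedSample

/-- The level `b (2 ^ R * q)` has rank about `1 / 2 ^ R` at size `q`, so it lies below every level
of smaller rank. This lets the first moment bound control the excess over `tailLevel γ a b q t`. -/
theorem IsTailNormalization.eventually_lt_tailLevel {μ : Measure ℝ} [IsProbabilityMeasure μ]
    {γ : ℝ} {a b : ℕ → ℝ} (h : IsTailNormalization μ γ a b) (R : ℕ) {t : ℝ} (ht : 0 < t)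
    (htR : t < 1 / 2 ^ R) : ∀ᶠ q in atTop, b (2 ^ R * q) < tailLevel γ a b q t := by
  have h2 : Tendsto (fun q : ℕ => 2 ^ R * q) atTop atTop :=
    tendsto_id.const_mul_atTop' (by positivity)
  have h1 : Tendsto (fun q : ℕ => (q : ℝ) * μ.real (Set.Ioi (b (2 ^ R * q)))) atTop
      (𝓝 (1 / 2 ^ R)) := by
    refine (((h.tendsto_tail 1 one_pos).comp h2).div_const (2 ^ R)).congr fun q => ?_
    simp only [Function.comp_apply, tailLevel, gevTailQuantile_one, mul_zero, zero_add]
    push_cast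
    field_simp
  filter_upwards [(h.tendsto_tail t ht).eventually_lt h1 htR] with q hq
  by_contra! hle
  exact hq.not_ge (mul_le_mul_of_nonneg_left
    (measureReal_mono (Set.Ioi_subset_Ioi hle)) q.cast_nonneg)

namespace IsAttractedSample

variable {Ω : Type*} [MeasurableSpace Ω] {P : Measure Ω} {X : ℕ → Ω → ℝ}
  {μ : Measure ℝ} {γ : ℝ} {a b : ℕ → ℝ} {m : ℕ → ℕ}

theorem exists_measure_relExcess_le [IsProbabilityMeasure μ]
    (h : IsAttractedSample P X μ γ a b m) (hγ : γ < 1) :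
    ∃ C θ : ℝ, 0 < C ∧ 0 < θ ∧ θ < 1 ∧ ∀ (R : ℕ) (ε t : ℝ), 0 < ε → 0 < t → t < 1 / 2 ^ R →
      ∀ᶠ n in atTop, P {ω | ε ≤ relExcess X γ a b m t (n, ω)} ≤
        ENNReal.ofReal (C * θ ^ R / ε) := by
  obtain ⟨C, θ, hC, hθ0, hθ1, hbound⟩ := h.tail.exists_lintegral_excess_le hγ
  refine ⟨2 * C, θ, by positivity, hθ0, hθ1, fun R ε t hε ht htR => ?_⟩
  filter_upwards [h.inter.tendsto_div.eventually hbound,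
    h.inter.tendsto_div.eventually (h.tail.eventually_lt_tailLevel R ht htR),
    h.inter.1.eventually_gt_atTop 0, h.inter.tendsto_div.eventually_gt_atTop 0,
    h.inter.tendsto_div_mul.eventually_lt_const one_lt_two] with n h1 h2 hmn hpn h3
  set p := n / m n
  have ha := h.tail.pos p
  have hm' : (0 : ℝ) < m n := by exact_mod_cast hmn
  have hp' : (0 : ℝ) < p := by exact_mod_cast hpn
  have hE : 0 < ε * (m n * a p) := by positivity
  calc P {ω | ε ≤ relExcess X γ a b m t (n, ω)}
      ≤ P {ω | ε * (m n * a p) ≤ totalExcess (fun i => X i ω) n (tailLevel γ a b p t)} := by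
        refine measure_mono fun ω hω => ?_
        exact (le_div_iff₀ (mul_pos hm' ha)).1 hω
    _ ≤ n * (∫⁻ x, ENNReal.ofReal (max (x - tailLevel γ a b p t) 0) ∂μ) /
          ENNReal.ofReal (ε * (m n * a p)) := measure_le_totalExcess_le h.hasLaw _ _ hE
    _ ≤ n * ENNReal.ofReal (C * θ ^ R * a p / p) / ENNReal.ofReal (ε * (m n * a p)) := by
        gcongr
        refine (lintegral_mono fun x => ENNReal.ofReal_le_ofReal ?_).trans (h1 R)
        exact max_le_max (by linarith) le_rfl
    _ = ENNReal.ofReal (n / (p * m n) * (C * θ ^ R / ε)) := by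
        rw [← ENNReal.ofReal_natCast, ← ENNReal.ofReal_mul (by positivity),
          ← ENNReal.ofReal_div_of_pos hE]
        congr 1
        field_simp
    _ ≤ _ := by
        refine ENNReal.ofReal_le_ofReal ?_
        have : 0 ≤ C * θ ^ R / ε := by positivity
        calc n / (p * m n) * (C * θ ^ R / ε) ≤ 2 * (C * θ ^ R / ε) := by gcongr
          _ = _ := by ring

variable {ι : Type*} {L : Filter ι} {z : ι → ℕ × Ω} {k : ι → ℕ} {s : ℝ}

/-- The filter `L` only has to map to `whp P`. Taking later the product of `whp P` with
neighbourhoods of `t` makes the convergence continuous in `t`. -/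
theorem eventually_rank_mem (h : IsAttractedSample P X μ γ a b m) (hz : Tendsto z L (whp P))
    (hk : Tendsto (fun i => (k i : ℝ) / m (z i).1) L (𝓝 s)) (hs : 0 < s) :
    ∀ᶠ i in L, 0 < m (z i).1 ∧ 1 ≤ k i ∧ k i ≤ (z i).1 := by
  have hn := tendsto_fst_whp.comp hz
  filter_upwards [hn.eventually (h.inter.1.eventually_gt_atTop 0), hk.eventually_const_lt hs,
    hk.eventually_lt_const (lt_add_one s),
    hn.eventually (h.inter.tendsto_ratio.eventually_gt_atTop (s + 1))] with i h1 h2 h3 h4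
  simp only [Function.comp_apply] at h1 h4
  have hm' : (0 : ℝ) < m (z i).1 := by exact_mod_cast h1
  refine ⟨h1, ?_, ?_⟩
  · by_contra hk0
    have : k i = 0 := by omega
    simp [this] at h2
  · have := (div_lt_div_iff_of_pos_right hm').1 (h3.trans h4)
    exact_mod_cast this.le

variable [IsProbabilityMeasure P]

theorem tendsto_relExcess [IsProbabilityMeasure μ] (h : IsAttractedSample P X μ γ a b m)
    (hγ : γ < 1) (hs : 0 < s) :
    Tendsto (relExcess X γ a b m s) (whp P) (𝓝 (gevExcess γ s)) := by
  rw [Metric.tendsto_nhds]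
  intro ε hε
  refine eventually_whp_of_forall_eventually_le fun η hη => ?_
  obtain ⟨C, θ, hC, hθ0, hθ1, hbound⟩ := h.exists_measure_relExcess_le hγ
  have ht0 : Tendsto (fun R : ℕ => (1 / 2 : ℝ) ^ (R + 1)) atTop (𝓝 0) :=
    (tendsto_pow_atTop_nhds_zero_of_lt_one (by norm_num) (by norm_num)).comp (tendsto_add_atTop_nat 1)
  have hp0 : Tendsto (fun R : ℕ => C * θ ^ R / (ε / 4)) atTop (𝓝 0) := by
    have := ((tendsto_pow_atTop_nhds_zero_of_lt_one hθ0.le hθ1).const_mul C).div_const (ε / 4)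
    rwa [mul_zero, zero_div] at this
  obtain ⟨R, ⟨hR1, hR2⟩, hR3⟩ := (((ht0.eventually_lt_const hs).and
    (hp0.eventually_lt_const (half_pos hη))).and
    (((tendsto_gevExcess_zero hγ).comp ht0).eventually_lt_const
      (show 0 < ε / 4 by positivity))).exists
  -- The excess is split at `t`: the part between `t` and `s` has error at most `ε / 2`, while the
  -- part above the level of rank `t` and `A t` are each below `ε / 4`.
  set t : ℝ := (1 / 2) ^ (R + 1) with ht
  have htpos : 0 < t := by positivity
  have htR : t < 1 / 2 ^ R := by
    rw [ht, pow_succ, one_div_pow]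
    have : (0 : ℝ) < 1 / 2 ^ R := by positivity
    linarith
  have hA := gevExcess_nonneg hγ htpos.le
  have hsub := (Metric.tendsto_nhds.1 (h.tendsto_relExcess_sub hγ htpos hR1)) (ε / 2) (by positivity)
  rw [eventually_whp_iff, ENNReal.tendsto_nhds_zero] at hsub
  filter_upwards [hsub (ENNReal.ofReal (η / 2)) (by simpa using hη),
    hbound R (ε / 4) t (by positivity) htpos htR] with n h1 h2
  calc _ ≤ P ({ω | ¬ dist (relExcess X γ a b m s (n, ω) - relExcess X γ a b m t (n, ω))
            (gevExcess γ s - gevExcess γ t) < ε / 2} ∪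
          {ω | ε / 4 ≤ relExcess X γ a b m t (n, ω)}) := by
        refine measure_mono fun ω hω => ?_
        by_contra hcon
        simp only [Set.mem_union, Set.mem_ofPred_eq, not_or, not_not, not_le] at hcon
        obtain ⟨hc1, hc2⟩ := hcon
        refine hω ?_
        have hnn : 0 ≤ relExcess X γ a b m t (n, ω) :=
          div_nonneg (Finset.sum_nonneg fun i _ => le_max_right _ _)
            (mul_nonneg (Nat.cast_nonneg _) (h.tail.pos _).le)
        rw [Real.dist_eq, abs_lt] at hc1 ⊢
        simp only [Function.comp_apply] at hR3
        constructor <;> linarith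
    _ ≤ ENNReal.ofReal (η / 2) + ENNReal.ofReal (η / 2) :=
        (measure_union_le _ _).trans
          (add_le_add h1 (h2.trans (ENNReal.ofReal_le_ofReal hR2.le)))
    _ = ENNReal.ofReal η := by
        rw [← ENNReal.ofReal_add (by positivity) (by positivity), add_halves]

/-! ### Limits of order statistics and of their averages -/

theorem tendsto_descOrderStat (h : IsAttractedSample P X μ γ a b m) (hz : Tendsto z L (whp P))
    (hk : Tendsto (fun i => (k i : ℝ) / m (z i).1) L (𝓝 s)) (hs : 0 < s) :
    Tendsto (fun i => (descOrderStat (fun j => X j (z i).2) (z i).1 (k i) -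
      b ((z i).1 / m (z i).1)) / a ((z i).1 / m (z i).1)) L (𝓝 (gevTailQuantile γ s)) := by
  have hc := continuousAt_gevTailQuantile (γ := γ) hs
  rw [tendsto_order]
  constructor
  · intro v hv
    have hev : ∀ᶠ t in 𝓝[>] s, v < gevTailQuantile γ t :=
      (hc.eventually_const_lt hv).filter_mono nhdsWithin_le_nhds
    obtain ⟨t, ht, hts⟩ := (hev.and self_mem_nhdsWithin).exists
    have hts' : s < t := hts
    filter_upwards [hk.eventually_lt ((h.tendsto_relExceedCount (hs.trans hts')).comp hz) hts',
      h.eventually_rank_mem hz hk hs] with i h1 ⟨hm, hk1, hkn⟩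
    have hm' : (0 : ℝ) < m (z i).1 := by exact_mod_cast hm
    refine ht.trans ?_
    rw [Function.comp_apply, relExceedCount, div_lt_div_iff_of_pos_right hm', Nat.cast_lt] at h1
    have h2 := (lt_descOrderStat_iff hk1 hkn _).2 h1.le
    rw [lt_div_iff₀ (h.tail.pos _)]
    simp only [tailLevel] at h2
    linarith
  · intro v hv
    have hev : ∀ᶠ t in 𝓝[<] s, gevTailQuantile γ t < v :=
      (hc.eventually_lt_const hv).filter_mono nhdsWithin_le_nhds
    obtain ⟨t, ⟨ht, ht0⟩, hts⟩ := ((hev.and ((eventually_gt_nhds hs).filter_mono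
      nhdsWithin_le_nhds)).and self_mem_nhdsWithin).exists
    have hts' : t < s := hts
    filter_upwards [((h.tendsto_relExceedCount ht0).comp hz).eventually_lt hk hts',
      h.eventually_rank_mem hz hk hs] with i h1 ⟨hm, hk1, hkn⟩
    have hm' : (0 : ℝ) < m (z i).1 := by exact_mod_cast hm
    refine lt_of_le_of_lt ?_ ht
    rw [Function.comp_apply, relExceedCount, div_lt_div_iff_of_pos_right hm', Nat.cast_lt] at h1
    have h2 := (descOrderStat_le_iff hk1 hkn _).2 h1
    rw [div_le_iff₀ (h.tail.pos _)]
    simp only [tailLevel] at h2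
    linarith

/-- From below, `Y_k` equals `X_k` plus the total excess over `X_k` divided by `k`, and `X_k` lies
below the level of any rank `t < s`. From above, the level of rank `s` itself gives a bound,
whatever `X_k` is. -/
theorem tendsto_cvarOrderStat [IsProbabilityMeasure μ] (h : IsAttractedSample P X μ γ a b m)
    (hγ : γ < 1) (hz : Tendsto z L (whp P))
    (hk : Tendsto (fun i => (k i : ℝ) / m (z i).1) L (𝓝 s)) (hs : 0 < s) :
    Tendsto (fun i => (cvarOrderStat (fun j => X j (z i).2) (z i).1 (k i) -
      b ((z i).1 / m (z i).1)) / a ((z i).1 / m (z i).1)) L (𝓝 (gevCVaR γ s)) := by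
  have hord := h.tendsto_descOrderStat hz hk hs
  rw [tendsto_order]
  constructor
  · intro y hy
    have hcont : ContinuousAt (fun t => gevTailQuantile γ s + gevExcess γ t / s) s :=
      continuousAt_const.add ((continuousAt_gevExcess hγ hs).div_const s)
    have hev : ∀ᶠ t in 𝓝[<] s, y < gevTailQuantile γ s + gevExcess γ t / s :=
      (hcont.eventually_const_lt hy).filter_mono nhdsWithin_le_nhds
    obtain ⟨t, ⟨ht, ht0⟩, hts⟩ := ((hev.and ((eventually_gt_nhds hs).filter_mono
      nhdsWithin_le_nhds)).and self_mem_nhdsWithin).exists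
    have hts' : t < s := hts
    have hlim := hord.add (((h.tendsto_relExcess hγ ht0).comp hz).div hk hs.ne')
    filter_upwards [hlim.eventually_const_lt ht,
      hord.eventually_lt_const (gevTailQuantile_lt ht0 hts'),
      h.eventually_rank_mem hz hk hs] with i h1 h2 ⟨hm, hk1, hkn⟩
    refine h1.trans_le ?_
    have ha := h.tail.pos ((z i).1 / m (z i).1)
    have hm' : (0 : ℝ) < m (z i).1 := by exact_mod_cast hm
    have hk' : (0 : ℝ) < k i := by exact_mod_cast hk1
    rw [div_lt_iff₀ ha] at h2
    have h3 := totalExcess_antitone (x := fun j => X j (z i).2) (n := (z i).1)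
      (show descOrderStat (fun j => X j (z i).2) (z i).1 (k i) ≤
        tailLevel γ a b ((z i).1 / m (z i).1) t by simp only [tailLevel]; linarith)
    rw [← mul_cvarOrderStat_sub_descOrderStat hk1 hkn] at h3
    simp only [Pi.div_apply, Function.comp_apply, relExcess]
    rw [le_div_iff₀ ha]
    field_simp
    linarith
  · intro y hy
    have hlim := (((h.tendsto_relExcess hγ hs).comp hz).div hk hs.ne').const_add
      (gevTailQuantile γ s)
    filter_upwards [hlim.eventually_lt_const hy, h.eventually_rank_mem hz hk hs]
      with i h1 ⟨hm, hk1, hkn⟩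
    refine lt_of_le_of_lt ?_ h1
    have ha := h.tail.pos ((z i).1 / m (z i).1)
    have hm' : (0 : ℝ) < m (z i).1 := by exact_mod_cast hm
    have hk' : (0 : ℝ) < k i := by exact_mod_cast hk1
    have h2 := mul_cvarOrderStat_sub_le (x := fun j => X j (z i).2) hk1 hkn
      (tailLevel γ a b ((z i).1 / m (z i).1) s)
    simp only [Pi.div_apply, Function.comp_apply, relExcess]
    rw [div_le_iff₀ ha]
    have h3 : totalExcess (fun j => X j (z i).2) (z i).1
        (tailLevel γ a b ((z i).1 / m (z i).1) s) /
        (m (z i).1 * a ((z i).1 / m (z i).1)) / (k i / m (z i).1) * a ((z i).1 / m (z i).1) =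
        totalExcess (fun j => X j (z i).2) (z i).1
          (tailLevel γ a b ((z i).1 / m (z i).1) s) / k i := by
      field_simp
    rw [add_mul, h3]
    have h4 := (le_div_iff₀' hk').2 h2
    simp only [tailLevel] at h4 ⊢
    linarith

end IsAttractedSample

/-! ### The spacing of the two largest observations -/

theorem exists_descOrderStat_eq_pair {x : ℕ → ℝ} {n k l : ℕ} (hk : 1 ≤ k) (hkn : k ≤ n)
    (hl : 1 ≤ l) (hln : l ≤ n) (hkl : k ≠ l) :
    ∃ i < n, ∃ j < n, i ≠ j ∧ x i = descOrderStat x n k ∧ x j = descOrderStat x n l := by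
  refine ⟨Tuple.sort (fun i : Fin n => x i) ⟨n - k, by omega⟩, Fin.is_lt _,
    Tuple.sort (fun i : Fin n => x i) ⟨n - l, by omega⟩, Fin.is_lt _, ?_, ?_, ?_⟩
  · intro h
    have := (Tuple.sort fun i : Fin n => x i).injective (Fin.ext h)
    rw [Fin.mk.injEq] at this
    omega
  · rw [descOrderStat_eq hk hkn]
    rfl
  · rw [descOrderStat_eq hl hln]
    rfl

/-- The union of two adjacent cells of the decreasing grid `u`. -/
def doubleCell (u : ℕ → ℝ) : ℕ → Set ℝ
  | 0 => Set.Ioi (u 1)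
  | j + 1 => Set.Ioc (u (j + 2)) (u j)

theorem measurableSet_doubleCell (u : ℕ → ℝ) (j : ℕ) : MeasurableSet (doubleCell u j) := by
  cases j
  · exact measurableSet_Ioi
  · exact measurableSet_Ioc

theorem exists_mem_doubleCell {u : ℕ → ℝ} {N : ℕ} {w y₁ y₂ : ℝ} (hN : 0 < N)
    (hu : ∀ j < N, u (j + 1) < u j) (hw : ∀ j < N, w ≤ u j - u (j + 1)) (hy : y₂ ≤ y₁)
    (hyw : y₁ - y₂ ≤ w) (hyN : u N < y₂) :
    ∃ j < N, y₁ ∈ doubleCell u j ∧ y₂ ∈ doubleCell u j := by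
  classical
  have hex : ∃ j, u j < y₂ := ⟨N, hyN⟩
  have hspec := Nat.find_spec hex
  have hmin : ∀ i < Nat.find hex, y₂ ≤ u i := fun i hi => not_lt.1 (Nat.find_min hex hi)
  have hle : Nat.find hex ≤ N := Nat.find_min' hex hyN
  generalize Nat.find hex = j at *
  -- Here `j` is the first grid index below `y₂`. For `j = 0` and `j = 1` the unbounded top cell
  -- contains both points; otherwise `y₁ ≤ y₂ + w` reaches at most one cell further up.
  rcases j with _ | _ | i
  · have := hu 0 hN
    exact ⟨0, hN, (this.trans hspec).trans_le hy, this.trans hspec⟩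
  · exact ⟨0, hN, lt_of_lt_of_le hspec hy, hspec⟩
  · have h1 := hmin (i + 1) (by omega)
    have h2 := hw i (by omega)
    have h3 := hu i (by omega)
    exact ⟨i + 1, by omega, ⟨lt_of_lt_of_le hspec hy, by linarith⟩, ⟨hspec, by linarith⟩⟩

theorem IsTailNormalization.tendsto_measure_doubleCell {μ : Measure ℝ} [IsProbabilityMeasure μ]
    {γ : ℝ} {a b : ℕ → ℝ} (h : IsTailNormalization μ γ a b) {d : ℝ} (hd : 0 < d) (j : ℕ) :
    Tendsto (fun q : ℕ => (q : ℝ) *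
      μ.real (doubleCell (fun i => tailLevel γ a b q ((i + 1) * d)) j)) atTop (𝓝 (2 * d)) := by
  cases j with
  | zero =>
    have := h.tendsto_tail (2 * d) (by positivity)
    refine this.congr fun q => ?_
    simp only [doubleCell]
    norm_num
  | succ j =>
    have h1 := (h.tendsto_tail ((j + 3) * d) (by positivity)).sub
      (h.tendsto_tail ((j + 1) * d) (by positivity))
    rw [show ((j : ℝ) + 3) * d - (j + 1) * d = 2 * d by ring] at h1
    refine h1.congr fun q => ?_
    have h2 := h.tailLevel_lt q (s := (j + 1) * d) (t := (j + 3) * d) (by positivity)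
      (by gcongr; norm_num)
    simp only [doubleCell]
    rw [show ((j + 2 : ℕ) + 1 : ℝ) * d = (j + 3) * d by push_cast; ring,
      ← Set.Ioi_sdiff_Ioi, measureReal_sdiff (Set.Ioi_subset_Ioi h2.le) measurableSet_Ioi]
    ring

section TopGap

variable {Ω : Type*} [MeasurableSpace Ω] {P : Measure Ω} [IsProbabilityMeasure P]
  {X : ℕ → Ω → ℝ} {μ : Measure ℝ} [IsProbabilityMeasure μ] {γ : ℝ} {a b : ℕ → ℝ}

/-- The gap between the two largest observations is not of smaller order than the scale. -/
theorem eventually_whp_lt_descOrderStat_sub (hX : ∀ i, HasLaw (X i) μ P) (hindep : iIndepFun X P)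
    (h : IsTailNormalization μ γ a b) {q : ℕ → ℕ} (hq : Tendsto q atTop atTop)
    (hqn : ∀ᶠ n in atTop, q n ≤ n ∧ n < 2 * q n) {δ : ℕ → ℝ} (hδ : Tendsto δ atTop (𝓝 0)) :
    ∀ᶠ z : ℕ × Ω in whp P, δ z.1 * a (q z.1) <
      descOrderStat (fun i => X i z.2) z.1 1 - descOrderStat (fun i => X i z.2) z.1 2 := by
  refine eventually_whp_of_forall_eventually_le fun η hη => ?_
  -- The lowest grid level has rank `S`, and too few exceedances of it cost `36 / S ≤ η / 2`. The
  -- grid has step `1 / J` in rank, and pairs sharing one of its fewer than `S * J` double cells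
  -- cost at most `25 * S / J ≤ η / 2`. The grid is fixed before `n`, so `δ` is eventually smaller
  -- than every cell.
  obtain ⟨S, hS⟩ := exists_nat_gt (max 4 (72 / η))
  obtain ⟨hS4, hSη⟩ := max_lt_iff.1 hS
  have hS0 : (0 : ℝ) < S := by linarith
  obtain ⟨J, hJ⟩ := exists_nat_gt (max 1 (50 * S / η))
  obtain ⟨hJ1, hJη⟩ := max_lt_iff.1 hJ
  have hJ0 : (0 : ℝ) < J := by linarith
  have hSJ : 1 < S * J := by
    have : (1 : ℝ) < S * J := by nlinarith
    exact_mod_cast this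
  set N := S * J - 1 with hN
  set d : ℝ := 1 / J with hd
  have hd0 : 0 < d := by positivity
  have hcast : ((N : ℝ) + 1) = S * J := by
    have : N + 1 = S * J := by omega
    exact_mod_cast this
  have hNd : ((N : ℝ) + 1) * d = S := by
    rw [hcast, hd]
    field_simp
  have hcells : ∀ᶠ n in atTop, ∀ j ∈ Finset.range N, (q n : ℝ) * μ.real
      (doubleCell (fun i => tailLevel γ a b (q n) ((i + 1) * d)) j) < 5 / 2 * d :=
    (Finset.eventually_all _).2 fun j _ => hq.eventually
      ((h.tendsto_measure_doubleCell hd0 j).eventually_lt_const (by linarith))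
  have hwidth : ∀ᶠ n in atTop, ∀ j ∈ Finset.range N, δ n <
      gevTailQuantile γ ((j + 1) * d) - gevTailQuantile γ ((j + 1 + 1) * d) :=
    (Finset.eventually_all _).2 fun j _ => hδ.eventually_lt_const (sub_pos.2
      (gevTailQuantile_lt (by positivity) (by gcongr; linarith)))
  have hT := hq.eventually ((h.tendsto_tail S hS0).eventually
    (Ioo_mem_nhds (show S * (9 / 10 : ℝ) < S by linarith) (show (S : ℝ) < S * (11 / 10) by linarith)))
  filter_upwards [hcells, hwidth, hT, hqn, eventually_ge_atTop 2] with n h1 h2 ⟨h3, h4⟩ ⟨h5, h6⟩ hn2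
  set u : ℕ → ℝ := fun i => tailLevel γ a b (q n) ((i + 1) * d) with hu
  have huN : u N = tailLevel γ a b (q n) S := by simp only [hu, hNd]
  have h5' : (q n : ℝ) ≤ n := by exact_mod_cast h5
  have h6' : (n : ℝ) ≤ 2 * q n := by exact_mod_cast h6.le
  set T := μ.real (Set.Ioi (u N)) with hTdef
  rw [← huN] at h3 h4
  have hT0 : 0 ≤ T := measureReal_nonneg
  have hlow : S * (9 / 10 : ℝ) < n * T := h3.trans_le (by gcongr)
  have hup : n * T < S * (22 / 10 : ℝ) := by
    calc n * T ≤ 2 * q n * T := by gcongr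
      _ < _ := by linarith
  have hu1 : ∀ j < N, u (j + 1) < u j := fun j _ =>
    h.tailLevel_lt _ (by positivity) (by push_cast; gcongr; linarith)
  have hu2 : ∀ j < N, δ n * a (q n) ≤ u j - u (j + 1) := fun j hj => by
    have h7 := mul_le_mul_of_nonneg_right (h2 j (Finset.mem_range.2 hj)).le (h.pos (q n)).le
    simp only [hu, tailLevel]
    push_cast
    linarith
  -- A small spacing forces one of two events: fewer than two observations exceed the lowest level,
  -- or two distinct observations share a double cell.
  have hsub : {ω | ¬ δ n * a (q n) < descOrderStat (fun i => X i ω) n 1 -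
      descOrderStat (fun i => X i ω) n 2} ⊆
      {ω | (S : ℝ) / 4 ≤ |(exceedCount (fun i => X i ω) n (u N) : ℝ) - n * T|} ∪
      ⋃ j ∈ Finset.range N, {ω | ∃ i < n, ∃ i' < n, i ≠ i' ∧ X i ω ∈ doubleCell u j ∧
        X i' ω ∈ doubleCell u j} := by
    intro ω hω
    simp only [Set.mem_ofPred_eq, not_lt] at hω
    by_cases hc : 2 ≤ exceedCount (fun i => X i ω) n (u N)
    · right
      have hy2 := (lt_descOrderStat_iff (by norm_num) hn2 (u N)).2 hc
      obtain ⟨j, hj, hj1, hj2⟩ := exists_mem_doubleCell (u := u) (N := N)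
        (w := δ n * a (q n)) (by omega) hu1 hu2
        (descOrderStat_anti le_rfl one_le_two hn2) hω hy2
      obtain ⟨i, hi, i', hi', hne, e1, e2⟩ := exists_descOrderStat_eq_pair
        (x := fun i => X i ω) le_rfl (by omega : 1 ≤ n) one_le_two hn2 (by norm_num)
      simp only [Set.mem_iUnion]
      refine ⟨j, Finset.mem_range.2 hj, i, hi, i', hi', hne, ?_, ?_⟩
      · rw [← e1] at hj1
        exact hj1
      · rw [← e2] at hj2
        exact hj2
    · left
      have hc' : (exceedCount (fun i => X i ω) n (u N) : ℝ) ≤ 1 := by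
        have : exceedCount (fun i => X i ω) n (u N) ≤ 1 := by omega
        exact_mod_cast this
      simp only [Set.mem_ofPred_eq]
      rw [abs_sub_comm]
      refine le_trans ?_ (le_abs_self _)
      linarith
  refine (measure_mono hsub).trans ((measure_union_le _ _).trans ?_)
  calc _ ≤ ENNReal.ofReal (n * T / (S / 4) ^ 2) +
        ∑ j ∈ Finset.range N, ENNReal.ofReal ((n * μ.real (doubleCell u j)) ^ 2) := by
        gcongr
        · exact measure_le_abs_exceedCount_sub_le hX hindep n (u N) (by positivity)
        · exact (measure_biUnion_finset_le _ _).trans (Finset.sum_le_sum fun j _ =>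
            measure_exists_pair_mem_le hX hindep n (measurableSet_doubleCell u j))
    _ ≤ ENNReal.ofReal (36 / S) + ∑ j ∈ Finset.range N, ENNReal.ofReal ((5 * d) ^ 2) := by
        refine add_le_add (ENNReal.ofReal_le_ofReal ?_) (Finset.sum_le_sum fun j hj =>
          ENNReal.ofReal_le_ofReal (pow_le_pow_left₀ (by positivity) ?_ 2))
        · rw [div_le_div_iff₀ (by positivity) hS0]
          nlinarith
        · have h7 := (h1 j hj).le
          calc n * μ.real (doubleCell u j) ≤ 2 * q n * μ.real (doubleCell u j) := by gcongr
            _ ≤ 5 * d := by linarith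
    _ = ENNReal.ofReal (36 / S + N * (5 * d) ^ 2) := by
        rw [Finset.sum_const, Finset.card_range, nsmul_eq_mul, ← ENNReal.ofReal_natCast,
          ← ENNReal.ofReal_mul (by positivity), ← ENNReal.ofReal_add (by positivity)
          (by positivity)]
    _ ≤ ENNReal.ofReal η := by
        refine ENNReal.ofReal_le_ofReal ?_
        have e1 : 36 / (S : ℝ) ≤ η / 2 := by
          rw [div_lt_iff₀ hη] at hSη
          rw [div_le_iff₀ hS0]
          linarith
        have e2 : (N : ℝ) * (5 * d) ^ 2 ≤ 25 * S / J := by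
          calc (N : ℝ) * (5 * d) ^ 2 = (N * d) * (25 * d) := by ring
            _ ≤ S * (25 * d) := by
                gcongr
                linarith
            _ = _ := by rw [hd]; ring
        have e3 : 25 * (S : ℝ) / J ≤ η / 2 := by
          rw [div_lt_iff₀ hη] at hJη
          rw [div_le_iff₀ hJ0]
          linarith
        linarith

end TopGap

/-! ### Power bounds for the gaps, uniform in the rank -/

/-- The ranks `j < l` of the two CVaR order statistics of a gap at rank `k`. -/
structure IsGapRanks (c : ℝ) (k j l : ℕ) : Prop where
  one_le : 1 ≤ j
  lt : j < l
  le : l ≤ k + 1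
  mul_le : c / 2 * k ≤ j
  mul_le_sub : (1 - c) / 2 * l ≤ l - j

namespace IsAttractedSample

variable {Ω : Type*} [MeasurableSpace Ω] {P : Measure Ω} [IsProbabilityMeasure P]
  {X : ℕ → Ω → ℝ} {μ : Measure ℝ} {γ : ℝ} {a b : ℕ → ℝ} {m : ℕ → ℕ}

theorem exists_eventually_gap_le [IsProbabilityMeasure μ] (h : IsAttractedSample P X μ γ a b m)
    (hγ : γ < 1) {c : ℝ} (hc : 0 < c) :
    ∃ C : ℝ, 0 < C ∧ ∀ᶠ z : ℕ × Ω in whp P, ∀ k j l, IsGapRanks c k j l → k ≤ m z.1 →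
      (cvarOrderStat (fun i => X i z.2) z.1 j - cvarOrderStat (fun i => X i z.2) z.1 l) /
        a (z.1 / m z.1) ≤ C * (m z.1 / k) := by
  have hA := gevExcess_nonneg hγ (show (0 : ℝ) ≤ 3 by norm_num)
  -- The level of rank `3` has more than `2 * m ≥ k + 1` exceedances with high probability, so it
  -- lies below `X_l` for all admissible ranks at once. Its total excess then bounds `j * (Y_j -
  -- Y_l)`, and `j ≥ c * k / 2`.
  refine ⟨2 * (gevExcess γ 3 + 1) / c, by positivity, ?_⟩
  filter_upwards [(h.tendsto_relExceedCount three_pos).eventually_const_lt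
      (show (2 : ℝ) < 3 by norm_num),
    (h.tendsto_relExcess hγ three_pos).eventually_lt_const (lt_add_one _),
    eventually_whp_fst h.inter.eventually_lt,
    eventually_whp_fst (h.inter.1.eventually_gt_atTop 0)] with z h1 h2 hmn hm k j l hr hkm
  have hm' : (0 : ℝ) < m z.1 := by exact_mod_cast hm
  have ha := h.tail.pos (z.1 / m z.1)
  have hj : (0 : ℝ) < j := by exact_mod_cast hr.one_le
  have hk : (0 : ℝ) < k := by
    have := hr.one_le
    have := hr.lt
    have := hr.le
    exact_mod_cast (by omega : 0 < k)
  rw [relExceedCount, lt_div_iff₀ hm'] at h1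
  rw [relExcess, div_lt_iff₀ (by positivity)] at h2
  have hl : l ≤ exceedCount (fun i => X i z.2) z.1 (tailLevel γ a b (z.1 / m z.1) 3) := by
    have h3 : 2 * m z.1 < exceedCount (fun i => X i z.2) z.1
        (tailLevel γ a b (z.1 / m z.1) 3) := by exact_mod_cast h1
    have := hr.le
    omega
  have hln : l ≤ z.1 := by
    have := hr.le
    omega
  have h4 := ((lt_descOrderStat_iff (hr.one_le.trans hr.lt.le) hln _).2 hl).le
  have h5 := mul_cvarOrderStat_sub_cvarOrderStat_le hr.one_le hr.lt.le hln h4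
  rw [div_le_iff₀ ha]
  have h6 : cvarOrderStat (fun i => X i z.2) z.1 j - cvarOrderStat (fun i => X i z.2) z.1 l ≤
      (gevExcess γ 3 + 1) * (m z.1 * a (z.1 / m z.1)) / j := by
    rw [le_div_iff₀' hj]
    exact h5.trans h2.le
  refine h6.trans ?_
  calc (gevExcess γ 3 + 1) * (m z.1 * a (z.1 / m z.1)) / j
      ≤ (gevExcess γ 3 + 1) * (m z.1 * a (z.1 / m z.1)) / (c / 2 * k) := by
        gcongr
        exact hr.mul_le
    _ = _ := by field_simp

/-- Simultaneous control of the exceedance counts at all dyadic scales down to the square root of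
the intermediate sequence. -/
theorem eventually_forall_abs_exceedCount_lt (h : IsAttractedSample P X μ γ a b m) {s : ℝ}
    (hs : 0 < s) :
    ∀ᶠ z : ℕ × Ω in whp P, ∀ r : ℕ, 4 ^ r ≤ m z.1 →
      |(exceedCount (fun i => X i z.2) z.1 (tailLevel γ a b (2 ^ r * (z.1 / m z.1)) s) : ℝ) * 2 ^ r
        - s * m z.1| < s * m z.1 / 2 := by
  -- At scale `r` Chebyshev costs `20 * 2 ^ r / (s * m)`. The geometric sum is governed by its last
  -- term, where `4 ^ r ≤ m` gives `2 ^ r ≤ √m`; this fixes the range of scales.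
  have hlim : Tendsto (fun n => 40 / s * (√(m n))⁻¹) atTop (𝓝 0) := by
    have := (Real.tendsto_sqrt_atTop.comp h.inter.tendsto_cast).inv_tendsto_atTop.const_mul (40 / s)
    rwa [mul_zero] at this
  refine eventually_whp_of_le hlim ?_
  obtain ⟨q₀, hq₀⟩ := eventually_atTop.1 ((h.tail.tendsto_tail s hs).eventually
    (Ioo_mem_nhds (show s * (9 / 10 : ℝ) < s by linarith) (show s < s * (11 / 10 : ℝ) by linarith)))
  filter_upwards [h.inter.tendsto_div.eventually_ge_atTop q₀, h.inter.1.eventually_gt_atTop 0,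
    h.inter.tendsto_div_mul.eventually (Ioo_mem_nhds (show (9 / 10 : ℝ) < 1 by norm_num)
      (show (1 : ℝ) < 11 / 10 by norm_num)), h.inter.tendsto_div.eventually_gt_atTop 0]
    with n hpn hmn ⟨h1, h2⟩ hp
  set p := n / m n with hpdef
  have hm' : (0 : ℝ) < m n := by exact_mod_cast hmn
  have hp' : (0 : ℝ) < p := by exact_mod_cast hp
  set T : ℕ → ℝ := fun r => μ.real (Set.Ioi (tailLevel γ a b (2 ^ r * p) s)) with hT
  have hmean : ∀ r, |n * T r * 2 ^ r - s * m n| < s * m n / 4 ∧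
      n * T r * 2 ^ r < 5 / 4 * (s * m n) := by
    intro r
    obtain ⟨h3, h4⟩ := hq₀ (2 ^ r * p) (hpn.trans (Nat.le_mul_of_pos_left p (by positivity)))
    push_cast at h3 h4
    have e : n * T r * 2 ^ r = (n / (p * m n)) * (2 ^ r * p * T r) * m n := by
      field_simp
    have hT0 : 0 ≤ 2 ^ r * p * T r := by positivity
    have e1 : s * (81 / 100) ≤ (n / (p * m n)) * (2 ^ r * p * T r) := by
      calc s * (81 / 100) = 9 / 10 * (s * (9 / 10)) := by ring
        _ ≤ _ := mul_le_mul h1.le h3.le (by positivity) (by positivity)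
    have e2 : (n / (p * m n)) * (2 ^ r * p * T r) ≤ s * (121 / 100) := by
      calc _ ≤ 11 / 10 * (s * (11 / 10)) := mul_le_mul h2.le h4.le hT0 (by norm_num)
        _ = _ := by ring
    have hsm : 0 < s * m n := by positivity
    have e3 := mul_le_mul_of_nonneg_right e1 hm'.le
    have e4 := mul_le_mul_of_nonneg_right e2 hm'.le
    rw [← e] at e3 e4
    rw [abs_lt]
    refine ⟨⟨?_, ?_⟩, ?_⟩ <;> linarith
  set R := Nat.log 4 (m n) with hR
  have hRm : (4 : ℝ) ^ R ≤ m n := by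
    exact_mod_cast Nat.pow_log_le_self 4 hmn.ne'
  have hsub : {ω | ¬ ∀ r : ℕ, 4 ^ r ≤ m n →
      |(exceedCount (fun i => X i ω) n (tailLevel γ a b (2 ^ r * p) s) : ℝ) * 2 ^ r
        - s * m n| < s * m n / 2} ⊆ ⋃ r ∈ Finset.range (R + 1),
      {ω | s * m n / (4 * 2 ^ r) ≤ |(exceedCount (fun i => X i ω) n
        (tailLevel γ a b (2 ^ r * p) s) : ℝ) - n * T r|} := by
    intro ω hω
    simp only [Set.mem_ofPred_eq, not_forall, not_lt] at hω
    obtain ⟨r, hr, hω⟩ := hω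
    simp only [Set.mem_iUnion]
    refine ⟨r, Finset.mem_range.2 (Nat.lt_succ_of_le (Nat.le_log_of_pow_le (by norm_num) hr)), ?_⟩
    have h5 := (hmean r).1
    set E : ℝ := (exceedCount (fun i => X i ω) n (tailLevel γ a b (2 ^ r * p) s) : ℝ)
    have h6 : |E * 2 ^ r - s * m n| ≤ |E - n * T r| * 2 ^ r + |n * T r * 2 ^ r - s * m n| := by
      calc |E * 2 ^ r - s * m n| = |(E - n * T r) * 2 ^ r + (n * T r * 2 ^ r - s * m n)| := by
            ring_nf
        _ ≤ |(E - n * T r) * 2 ^ r| + |n * T r * 2 ^ r - s * m n| := abs_add_le _ _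
        _ = _ := by rw [abs_mul, abs_of_pos (by positivity : (0 : ℝ) < 2 ^ r)]
    simp only [Set.mem_ofPred_eq]
    rw [div_le_iff₀ (by positivity)]
    linarith
  refine (measure_mono hsub).trans ((measure_biUnion_finset_le _ _).trans ?_)
  calc _ ≤ ∑ r ∈ Finset.range (R + 1), ENNReal.ofReal (20 / (s * m n) * 2 ^ r) := by
        refine Finset.sum_le_sum fun r _ => ?_
        refine (measure_le_abs_exceedCount_sub_le h.hasLaw h.indep n _ (by positivity)).trans
          (ENNReal.ofReal_le_ofReal ?_)
        have h5 := (hmean r).2.le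
        calc n * T r / (s * m n / (4 * 2 ^ r)) ^ 2
            = n * T r * 2 ^ r * (16 * 2 ^ r / (s * m n) ^ 2) := by field_simp; norm_num
          _ ≤ 5 / 4 * (s * m n) * (16 * 2 ^ r / (s * m n) ^ 2) := by gcongr
          _ = _ := by field_simp; norm_num
    _ = ENNReal.ofReal (20 / (s * m n) * (2 ^ (R + 1) - 1)) := by
        rw [← ENNReal.ofReal_sum_of_nonneg fun r _ => by positivity, ← Finset.mul_sum,
          geom_sum_eq (by norm_num)]
        norm_num
    _ ≤ _ := by
        refine ENNReal.ofReal_le_ofReal ?_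
        have h7 : (2 : ℝ) ^ R ≤ √(m n) := by
          refine Real.le_sqrt_of_sq_le ?_
          rw [← pow_mul, mul_comm, pow_mul]
          norm_num
          exact hRm
        calc 20 / (s * m n) * ((2 : ℝ) ^ (R + 1) - 1) ≤ 20 / (s * m n) * (2 * √(m n)) := by
              gcongr
              rw [pow_succ]
              linarith
          _ = 40 / s * (√(m n) / m n) := by field_simp; norm_num
          _ = _ := by rw [Real.sqrt_div_self]

end IsAttractedSample

theorem IsGapRanks.le_cvarOrderStat_sub {x : ℕ → ℝ} {n : ℕ} {c : ℝ} {i k j l : ℕ}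
    (hr : IsGapRanks c k j l) (hi : 1 ≤ i) (hij : i ≤ j) (hkn : k < n) :
    (1 - c) / 2 * (i / j) * (descOrderStat x n i - descOrderStat x n (j + 1)) ≤
      cvarOrderStat x n j - cvarOrderStat x n l := by
  have h1 := hr.one_le
  have h2 := hr.lt
  have h3 := hr.le
  have hl : (0 : ℝ) < l := by exact_mod_cast (by omega : 0 < l)
  have hanti : 0 ≤ descOrderStat x n i - descOrderStat x n (j + 1) :=
    sub_nonneg.2 (descOrderStat_anti hi (by omega) (by omega))
  refine le_trans ?_ (mul_descOrderStat_sub_le_cvarOrderStat_sub hi hij h2 (by omega))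
  have h4 : (1 - c) / 2 ≤ ((l : ℝ) - j) / l := by
    rw [le_div_iff₀ hl]
    exact hr.mul_le_sub
  gcongr

namespace IsAttractedSample

variable {Ω : Type*} [MeasurableSpace Ω] {P : Measure Ω}
  {X : ℕ → Ω → ℝ} {μ : Measure ℝ} [IsProbabilityMeasure μ] {γ : ℝ} {a b : ℕ → ℝ} {m : ℕ → ℕ}

/-- Once `(1 / 2) ^ D < ρ`, geometric decay in `r` becomes a power of `1 / 2 ^ r`, a quantity
comparable with `k / m`. -/
theorem exists_pow_scale_le (h : IsAttractedSample P X μ γ a b m) :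
    ∃ D : ℕ, ∀ᶠ n in atTop, ∀ r : ℕ,
      (1 / 2 ^ r : ℝ) ^ D * a (n / m n) ≤ a (2 ^ r * (n / m n)) := by
  obtain ⟨ρ, hρ0, hρ1, hρ⟩ := h.tail.exists_scale_lower_bound
  obtain ⟨D, hD⟩ := exists_pow_lt_of_lt_one hρ0 (show (1 / 2 : ℝ) < 1 by norm_num)
  refine ⟨D, ?_⟩
  filter_upwards [h.inter.tendsto_div.eventually hρ] with n hn r
  refine le_trans ?_ (hn r)
  have ha := (h.tail.pos (n / m n)).le
  gcongr
  calc (1 / 2 ^ r : ℝ) ^ D = ((1 / 2) ^ D) ^ r := by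
        rw [← one_div_pow, ← pow_mul, ← pow_mul, mul_comm]
    _ ≤ ρ ^ r := by gcongr

variable [IsProbabilityMeasure P]

theorem exists_eventually_le_gap_of_le_sq (h : IsAttractedSample P X μ γ a b m) {c : ℝ}
    (hc : 0 < c) (hc1 : c < 1) :
    ∃ κ : ℝ, 0 < κ ∧ ∃ D : ℕ, ∀ᶠ z : ℕ × Ω in whp P, ∀ k j l, IsGapRanks c k j l →
      k ≤ m z.1 → m z.1 ≤ k ^ 2 → κ * (k / m z.1 : ℝ) ^ D ≤
      (cvarOrderStat (fun i => X i z.2) z.1 j - cvarOrderStat (fun i => X i z.2) z.1 l) /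
        a (z.1 / m z.1) := by
  obtain ⟨D, hD⟩ := h.exists_pow_scale_le
  -- At scale `2 ^ r ≈ m / k`, the level of rank `c / 8` has fewer than `3 * c * k / 8 < j`
  -- exceedances, and that of rank `c / 16` has at least `c * k / 32`. So `X_i` and `X_(j+1)` are
  -- separated by at least `w * a (2 ^ r * p)`, with `i / j ≥ c / 32`.
  set w := gevTailQuantile γ (c / 16) - gevTailQuantile γ (c / 8) with hw
  have hw0 : 0 < w := sub_pos.2 (gevTailQuantile_lt (by positivity) (by linarith))
  have h1c : 0 < 1 - c := by linarith
  refine ⟨(1 - c) / 2 * (c / 32) * w, by positivity, D, ?_⟩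
  filter_upwards [h.eventually_forall_abs_exceedCount_lt (s := c / 16) (by positivity),
    h.eventually_forall_abs_exceedCount_lt (s := c / 8) (by positivity),
    eventually_whp_fst hD, eventually_whp_fst h.inter.eventually_lt,
    eventually_whp_fst (h.inter.1.eventually_gt_atTop 0)] with z hz1 hz2 hzD hmn hm k j l hr hkm hmk
  have hj1 := hr.one_le
  have hjl := hr.lt
  have hlk := hr.le
  have hcj := hr.mul_le
  have hm' : (0 : ℝ) < m z.1 := by exact_mod_cast hm
  have hj' : (0 : ℝ) < j := by exact_mod_cast hj1
  have hk0 : 0 < k := by omega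
  have hk' : (0 : ℝ) < k := by exact_mod_cast hk0
  set p := z.1 / m z.1
  have hap := h.tail.pos p
  set r := Nat.log 2 (m z.1 / k) with hrdef
  have hmk0 : m z.1 / k ≠ 0 := (Nat.div_pos hkm hk0).ne'
  have hr1 : 2 ^ r * k ≤ m z.1 :=
    (Nat.mul_le_mul_right k (Nat.pow_log_le_self 2 hmk0)).trans (Nat.div_mul_le_self _ _)
  have hr2 : m z.1 < 2 ^ (r + 1) * k :=
    (Nat.div_lt_iff_lt_mul hk0).1 (Nat.lt_pow_succ_log_self one_lt_two _)
  -- The assumption `m ≤ k ^ 2` is exactly what puts the scale in the controlled range.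
  have hr4 : 4 ^ r ≤ m z.1 := by
    have e1 : (2 ^ r * k) ^ 2 ≤ (m z.1) ^ 2 := Nat.pow_le_pow_left hr1 2
    have e2 : 4 ^ r * (m z.1) ≤ m z.1 * m z.1 := by
      calc 4 ^ r * m z.1 ≤ 4 ^ r * k ^ 2 := Nat.mul_le_mul_left _ hmk
        _ = (2 ^ r * k) ^ 2 := by rw [mul_pow, ← pow_mul, mul_comm r, pow_mul]; norm_num
        _ ≤ _ := by rw [← sq]; exact e1
    exact Nat.le_of_mul_le_mul_right e2 hm
  have hr1' : (2 : ℝ) ^ r * k ≤ m z.1 := by exact_mod_cast hr1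
  have hr2' : (m z.1 : ℝ) < 2 * (2 ^ r * k) := by
    have : (m z.1 : ℝ) < 2 ^ (r + 1) * k := by exact_mod_cast hr2
    rw [pow_succ] at this
    linarith
  have h2r : (0 : ℝ) < 2 ^ r := by positivity
  set u₁ := tailLevel γ a b (2 ^ r * p) (c / 16)
  set u₂ := tailLevel γ a b (2 ^ r * p) (c / 8)
  set i := exceedCount (fun i => X i z.2) z.1 u₁ with hi
  have hE1 := (abs_lt.1 (hz1 r hr4)).1
  have hE2 := (abs_lt.1 (hz2 r hr4)).2
  have hi0 : 1 ≤ i := by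
    by_contra hcon
    have hi00 : i = 0 := by omega
    rw [← hi, hi00] at hE1
    have : 0 < c * m z.1 := by positivity
    simp only [Nat.cast_zero, zero_mul] at hE1
    linarith
  have hjE : exceedCount (fun i => X i z.2) z.1 u₂ < j := by
    have e1 : (exceedCount (fun i => X i z.2) z.1 u₂ : ℝ) * 2 ^ r < j * 2 ^ r := by
      calc _ < 3 / 2 * (c / 8) * m z.1 := by linarith
        _ ≤ 3 / 2 * (c / 8) * (2 * (2 ^ r * k)) := by gcongr
        _ ≤ c / 2 * k * 2 ^ r := by
          have : 0 < c * k * 2 ^ r := by positivity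
          linarith
        _ ≤ j * 2 ^ r := by gcongr
    exact_mod_cast lt_of_mul_lt_mul_right e1 h2r.le
  have hin : i ≤ z.1 := by
    rw [hi, exceedCount]
    exact (Finset.card_filter_le _ _).trans (Finset.card_range _).le
  have hX1 := (lt_descOrderStat_iff (x := fun i => X i z.2) hi0 hin u₁).2 le_rfl
  have hX2 := (descOrderStat_le_iff (x := fun i => X i z.2) (n := z.1) (k := j + 1)
    (by omega) (by omega) u₂).2 (by omega)
  have hu : u₂ < u₁ := h.tail.tailLevel_lt _ (by positivity) (by linarith)
  have hij : i ≤ j := by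
    by_contra! hcon
    have := descOrderStat_anti (x := fun i => X i z.2) (n := z.1) (k := j + 1) (l := i)
      (by omega) hcon hin
    linarith
  have hdiff : a (2 ^ r * p) * w ≤ descOrderStat (fun i => X i z.2) z.1 i -
      descOrderStat (fun i => X i z.2) z.1 (j + 1) := by
    have : u₁ - u₂ = a (2 ^ r * p) * w := by
      simp only [u₁, u₂, tailLevel, hw]
      ring
    linarith
  have hratio : c / 32 ≤ (i : ℝ) / j := by
    rw [le_div_iff₀ hj']
    have hjk : (j : ℝ) ≤ k := by exact_mod_cast (by omega : j ≤ k)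
    have e1 : c / 32 * j * 2 ^ r ≤ i * 2 ^ r := by
      calc c / 32 * j * 2 ^ r ≤ c / 32 * k * 2 ^ r := by gcongr
        _ = c / 32 * (2 ^ r * k) := by ring
        _ ≤ c / 32 * m z.1 := by gcongr
        _ ≤ i * 2 ^ r := by linarith
    exact le_of_mul_le_mul_right e1 h2r
  have hpow : (k / m z.1 : ℝ) ≤ 1 / 2 ^ r := by
    rw [div_le_div_iff₀ hm' h2r]
    linarith
  rw [le_div_iff₀ hap]
  calc (1 - c) / 2 * (c / 32) * w * (k / m z.1 : ℝ) ^ D * a p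
      ≤ (1 - c) / 2 * (c / 32) * w * (1 / 2 ^ r : ℝ) ^ D * a p := by gcongr
    _ = (1 - c) / 2 * (c / 32) * (((1 / 2 ^ r : ℝ) ^ D * a p) * w) := by ring
    _ ≤ (1 - c) / 2 * (i / j) * (descOrderStat (fun i => X i z.2) z.1 i -
          descOrderStat (fun i => X i z.2) z.1 (j + 1)) := by
        refine mul_le_mul (by gcongr) ?_ (by positivity) (by positivity)
        refine le_trans ?_ hdiff
        gcongr
        exact hzD r
    _ ≤ _ := hr.le_cvarOrderStat_sub hi0 hij (by omega)

/-- Here any fixed power of `1 / m` may be lost, because `k ^ 2 < m` gives `(k / m) ^ 2 ≤ 1 / m`.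
The gap dominates `(X_1 - X_2) / j`, and with high probability the spacing exceeds `a q / m` for a
dyadic multiple `q` of `p` comparable with `n`. The factors `1 / j`, `1 / m` and `a q / a p` account
for the exponent `D + 2`. -/
theorem exists_eventually_le_gap_of_sq_lt (h : IsAttractedSample P X μ γ a b m) {c : ℝ}
    (hc1 : c < 1) :
    ∃ κ : ℝ, 0 < κ ∧ ∃ D : ℕ, ∀ᶠ z : ℕ × Ω in whp P, ∀ k j l, IsGapRanks c k j l →
      k ^ 2 < m z.1 → κ * (k / m z.1 : ℝ) ^ D ≤
      (cvarOrderStat (fun i => X i z.2) z.1 j - cvarOrderStat (fun i => X i z.2) z.1 l) /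
        a (z.1 / m z.1) := by
  obtain ⟨D, hD⟩ := h.exists_pow_scale_le
  have h1c : 0 < 1 - c := by linarith
  set r : ℕ → ℕ := fun n => Nat.log 2 (n / (n / m n)) with hrdef
  set q : ℕ → ℕ := fun n => 2 ^ r n * (n / m n) with hqdef
  have hq : Tendsto q atTop atTop :=
    tendsto_atTop_mono (fun n => Nat.le_mul_of_pos_left _ (by positivity)) h.inter.tendsto_div
  have hqn : ∀ᶠ n in atTop, q n ≤ n ∧ n < 2 * q n := by
    filter_upwards [h.inter.tendsto_div.eventually_gt_atTop 0, eventually_gt_atTop 0] with n hn hn0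
    have h0 : n / (n / m n) ≠ 0 := (Nat.div_pos (Nat.div_le_self _ _) hn).ne'
    refine ⟨(Nat.mul_le_mul_right _ (Nat.pow_log_le_self 2 h0)).trans (Nat.div_mul_le_self _ _), ?_⟩
    have := (Nat.div_lt_iff_lt_mul hn).1
      (Nat.lt_pow_succ_log_self one_lt_two (n / (n / m n)))
    rwa [pow_succ, mul_comm (2 ^ _) 2, mul_assoc] at this
  have htop := eventually_whp_lt_descOrderStat_sub h.hasLaw h.indep h.tail hq hqn
    h.inter.tendsto_cast.inv_tendsto_atTop
  refine ⟨(1 - c) / 2 * (1 / 2) ^ D, by positivity, 2 * (D + 2), ?_⟩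
  filter_upwards [htop, eventually_whp_fst hD, eventually_whp_fst h.inter.eventually_lt,
    eventually_whp_fst (h.inter.1.eventually_gt_atTop 0), eventually_whp_fst hqn,
    eventually_whp_fst (h.inter.tendsto_div.eventually_gt_atTop 0),
    eventually_whp_fst (h.inter.tendsto_div_mul.eventually_lt_const one_lt_two)]
    with z hz hzD hmn hm hqz hp hp2 k j l hr hkm
  have hj1 := hr.one_le
  have hjl := hr.lt
  have hlk := hr.le
  have hm' : (0 : ℝ) < m z.1 := by exact_mod_cast hm
  have hj' : (0 : ℝ) < j := by exact_mod_cast hj1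
  have hk0 : 0 < k := by omega
  have hk' : (0 : ℝ) < k := by exact_mod_cast hk0
  have hkm1 : k < m z.1 := lt_of_le_of_lt (by nlinarith) hkm
  have hp' : (0 : ℝ) < (z.1 / m z.1 : ℕ) := by exact_mod_cast hp
  have hap := h.tail.pos (z.1 / m z.1)
  have hgap := hr.le_cvarOrderStat_sub (x := fun i => X i z.2) (n := z.1) le_rfl hj1
    (by omega)
  have hX := descOrderStat_anti (x := fun i => X i z.2) (n := z.1) (k := 2) (l := j + 1)
    (by norm_num) (by omega) (by omega)
  have h2r : (2 : ℝ) ^ r z.1 ≤ 2 * m z.1 := by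
    rw [div_lt_iff₀ (by positivity)] at hp2
    have e1 : (2 : ℝ) ^ r z.1 * (z.1 / m z.1 : ℕ) ≤ z.1 := by exact_mod_cast hqz.1
    have e2 : (2 : ℝ) ^ r z.1 * (z.1 / m z.1 : ℕ) ≤ 2 * m z.1 * (z.1 / m z.1 : ℕ) := by linarith
    exact le_of_mul_le_mul_right e2 hp'
  have hjm : (j : ℝ) ≤ m z.1 := by exact_mod_cast (by omega : j ≤ m z.1)
  have hkm2 : ((k : ℝ) / m z.1) ^ 2 ≤ 1 / m z.1 := by
    have : (k : ℝ) ^ 2 ≤ m z.1 := by exact_mod_cast hkm.le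
    rw [div_pow, div_le_div_iff₀ (by positivity) hm']
    nlinarith
  rw [le_div_iff₀ hap]
  calc (1 - c) / 2 * (1 / 2) ^ D * (k / m z.1 : ℝ) ^ (2 * (D + 2)) * a (z.1 / m z.1)
      ≤ (1 - c) / 2 * (1 / 2) ^ D * (1 / m z.1 : ℝ) ^ (D + 2) * a (z.1 / m z.1) := by
        rw [pow_mul]
        gcongr
    _ = (1 - c) / 2 * (1 / m z.1) * ((m z.1 : ℝ)⁻¹ *
          ((1 / (2 * m z.1) : ℝ) ^ D * a (z.1 / m z.1))) := by
        simp only [one_div, mul_inv, mul_pow, inv_pow, pow_succ]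
        ring
    _ ≤ (1 - c) / 2 * (1 / j) * ((m z.1 : ℝ)⁻¹ * a (q z.1)) := by
        gcongr
        refine le_trans ?_ (hzD (r z.1))
        gcongr
    _ ≤ (1 - c) / 2 * ((1 : ℕ) / j) * (descOrderStat (fun i => X i z.2) z.1 1 -
          descOrderStat (fun i => X i z.2) z.1 (j + 1)) := by
        rw [Nat.cast_one]
        gcongr
        refine hz.le.trans ?_
        linarith
    _ ≤ _ := hgap

theorem exists_eventually_le_gap (h : IsAttractedSample P X μ γ a b m) {c : ℝ}
    (hc : 0 < c) (hc1 : c < 1) :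
    ∃ κ : ℝ, 0 < κ ∧ ∃ D : ℕ, ∀ᶠ z : ℕ × Ω in whp P, ∀ k j l, IsGapRanks c k j l →
      k ≤ m z.1 → κ * (k / m z.1 : ℝ) ^ D ≤
      (cvarOrderStat (fun i => X i z.2) z.1 j - cvarOrderStat (fun i => X i z.2) z.1 l) /
        a (z.1 / m z.1) := by
  obtain ⟨κ₁, hκ₁, D₁, h₁⟩ := h.exists_eventually_le_gap_of_le_sq hc hc1
  obtain ⟨κ₂, hκ₂, D₂, h₂⟩ := h.exists_eventually_le_gap_of_sq_lt hc1
  refine ⟨min κ₁ κ₂, lt_min hκ₁ hκ₂, max D₁ D₂, ?_⟩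
  filter_upwards [h₁, h₂] with z hz₁ hz₂ k j l hr hkm
  have h0 : (0 : ℝ) ≤ k / m z.1 := by positivity
  have h1 : (k / m z.1 : ℝ) ≤ 1 := div_le_one_of_le₀ (by exact_mod_cast hkm) (Nat.cast_nonneg _)
  rcases le_or_gt (m z.1) (k ^ 2) with hk | hk
  · refine le_trans ?_ (hz₁ k j l hr hkm hk)
    exact mul_le_mul (min_le_left _ _) (pow_le_pow_of_le_one h0 h1 (le_max_left _ _))
      (by positivity) hκ₁.le
  · refine le_trans ?_ (hz₂ k j l hr hk)
    exact mul_le_mul (min_le_right _ _) (pow_le_pow_of_le_one h0 h1 (le_max_right _ _))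
      (by positivity) hκ₂.le

end IsAttractedSample

/-! ### Ranks of the estimator, domination and conclusion -/

/-- The offset by one keeps `j` positive even if `c * k < 1`; the factor `1 / 2` in `mul_le_sub`
absorbs `l = k + 1 ≤ 2 * k`. Without the offset, the factor `1 / 2` in `mul_le` absorbs the floor
instead, once the floor is at least one. -/
theorem isGapRanks_one {c : ℝ} (hc0 : 0 < c) (hc1 : c < 1) {k : ℕ} (hk : 1 ≤ k) :
    IsGapRanks c k (⌊c * (k : ℝ)⌋₊ + 1) (k + 1) := by
  have hk' : (1 : ℝ) ≤ k := by exact_mod_cast hk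
  have h1 := Nat.floor_le (show 0 ≤ c * (k : ℝ) by positivity)
  have h2 := Nat.lt_floor_add_one (c * (k : ℝ))
  have hlt : ⌊c * (k : ℝ)⌋₊ < k := by
    rw [Nat.floor_lt (by positivity)]
    nlinarith
  refine ⟨by omega, by omega, le_rfl, ?_, ?_⟩
  · push_cast
    nlinarith
  · push_cast
    nlinarith

theorem isGapRanks_zero {c : ℝ} (hc0 : 0 < c) (hc1 : c < 1) {k : ℕ}
    (hk : 1 ≤ ⌊c * (k : ℝ)⌋₊) : IsGapRanks c k (⌊c * (k : ℝ)⌋₊ + 0) (k + 0) := by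
  have h1 := Nat.floor_le (show 0 ≤ c * (k : ℝ) by positivity)
  have h2 := Nat.lt_floor_add_one (c * (k : ℝ))
  have hk1 : (1 : ℝ) ≤ ⌊c * (k : ℝ)⌋₊ := by exact_mod_cast hk
  have hk' : (0 : ℝ) < k := by
    by_contra! hcon
    nlinarith
  have hlt : ⌊c * (k : ℝ)⌋₊ < k := by
    rw [Nat.floor_lt (by positivity)]
    nlinarith
  refine ⟨by omega, by omega, by omega, ?_, ?_⟩
  · push_cast
    linarith
  · push_cast
    nlinarith

theorem tendsto_natCast_div_of_abs_sub_le {ι : Type*} {L : Filter ι} {k : ι → ℕ} {x M : ι → ℝ}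
    {s C : ℝ} (hM : Tendsto M L atTop) (hx : Tendsto (fun i => x i / M i) L (𝓝 s))
    (hk : ∀ i, |(k i : ℝ) - x i| ≤ C) : Tendsto (fun i => (k i : ℝ) / M i) L (𝓝 s) := by
  have h0 : Tendsto (fun i => ((k i : ℝ) - x i) / M i) L (𝓝 0) := by
    have h1 := hM.inv_tendsto_atTop.const_mul C
    rw [mul_zero] at h1
    refine squeeze_zero_norm' ?_ h1
    filter_upwards [hM.eventually_gt_atTop 0] with i hi
    rw [Real.norm_eq_abs, abs_div, abs_of_pos hi, div_eq_mul_inv, Pi.inv_apply]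
    gcongr
    exact hk i
  have := h0.add hx
  rw [zero_add] at this
  refine this.congr fun i => ?_
  ring

namespace IsAttractedSample

variable {Ω : Type*} [MeasurableSpace Ω] {P : Measure Ω} [IsProbabilityMeasure P]
  {X : ℕ → Ω → ℝ} {μ : Measure ℝ} [IsProbabilityMeasure μ] {γ : ℝ} {a b : ℕ → ℝ} {m : ℕ → ℕ}

/-- The logarithms of normalized gaps converge continuously in the relative rank. -/
theorem tendsto_log_gap (h : IsAttractedSample P X μ γ a b m) (hγ : γ < 1) {c : ℝ}
    (hc : 0 < c) (hc1 : c < 1) (d : ℕ) (t : Set.Ioc (0 : ℝ) 1) :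
    Tendsto (fun y : (ℕ × Ω) × Set.Ioc (0 : ℝ) 1 => Real.log
      ((cvarOrderStat (fun i => X i y.1.2) y.1.1
          (⌊c * (⌈(y.2 : ℝ) * (m y.1.1 : ℝ)⌉₊ : ℝ)⌋₊ + d) -
        cvarOrderStat (fun i => X i y.1.2) y.1.1 (⌈(y.2 : ℝ) * (m y.1.1 : ℝ)⌉₊ + d)) /
        a (y.1.1 / m y.1.1)))
      (whp P ×ˢ 𝓝 t)
      (𝓝 (Real.log (gevTailQuantile γ c / (1 - γ)) + γ * Real.log (1 / (t : ℝ)))) := by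
  have ht : (0 : ℝ) < t := t.2.1
  have hz : Tendsto (fun y : (ℕ × Ω) × Set.Ioc (0 : ℝ) 1 => y.1) (whp P ×ˢ 𝓝 t) (whp P) :=
    tendsto_fst
  have hM : Tendsto (fun y : (ℕ × Ω) × Set.Ioc (0 : ℝ) 1 => (m y.1.1 : ℝ)) (whp P ×ˢ 𝓝 t) atTop :=
    h.inter.tendsto_cast.comp (tendsto_fst_whp.comp hz)
  have ht' : Tendsto (fun y : (ℕ × Ω) × Set.Ioc (0 : ℝ) 1 => (y.2 : ℝ)) (whp P ×ˢ 𝓝 t)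
      (𝓝 (t : ℝ)) := (continuous_subtype_val.tendsto t).comp tendsto_snd
  have hx : Tendsto (fun y : (ℕ × Ω) × Set.Ioc (0 : ℝ) 1 => (y.2 : ℝ) * m y.1.1 / m y.1.1)
      (whp P ×ˢ 𝓝 t) (𝓝 (t : ℝ)) := by
    refine ht'.congr' ?_
    filter_upwards [hM.eventually_gt_atTop 0] with y hy
    field_simp
  have hceil : ∀ y : (ℕ × Ω) × Set.Ioc (0 : ℝ) 1,
      |(⌈(y.2 : ℝ) * (m y.1.1 : ℝ)⌉₊ : ℝ) - (y.2 : ℝ) * m y.1.1| ≤ 1 := fun y => by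
    have h0 : 0 ≤ (y.2 : ℝ) * m y.1.1 := mul_nonneg y.2.2.1.le (Nat.cast_nonneg _)
    have h1 := Nat.le_ceil ((y.2 : ℝ) * m y.1.1)
    have h2 := Nat.ceil_lt_add_one h0
    rw [abs_le]
    constructor <;> linarith
  have hl : Tendsto (fun y : (ℕ × Ω) × Set.Ioc (0 : ℝ) 1 =>
      ((⌈(y.2 : ℝ) * (m y.1.1 : ℝ)⌉₊ + d : ℕ) : ℝ) / m y.1.1) (whp P ×ˢ 𝓝 t) (𝓝 (t : ℝ)) := by
    -- Rounding and the offset move a rank by a bounded amount, negligible against `m`.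
    refine tendsto_natCast_div_of_abs_sub_le (C := 1 + d) hM hx fun y => ?_
    have := abs_le.1 (hceil y)
    push_cast
    rw [abs_le]
    constructor <;> linarith [(Nat.cast_nonneg d : (0 : ℝ) ≤ d)]
  have hj : Tendsto (fun y : (ℕ × Ω) × Set.Ioc (0 : ℝ) 1 =>
      ((⌊c * (⌈(y.2 : ℝ) * (m y.1.1 : ℝ)⌉₊ : ℝ)⌋₊ + d : ℕ) : ℝ) / m y.1.1) (whp P ×ˢ 𝓝 t)
      (𝓝 (c * t)) := by
    have hx' : Tendsto (fun y : (ℕ × Ω) × Set.Ioc (0 : ℝ) 1 =>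
        c * ((y.2 : ℝ) * m y.1.1) / m y.1.1) (whp P ×ˢ 𝓝 t) (𝓝 (c * t)) := by
      refine (hx.const_mul c).congr fun y => ?_
      ring
    refine tendsto_natCast_div_of_abs_sub_le (C := 2 + d) hM hx' fun y => ?_
    have h1 := abs_le.1 (hceil y)
    set K : ℝ := (⌈(y.2 : ℝ) * (m y.1.1 : ℝ)⌉₊ : ℝ) with hK
    have hK0 : 0 ≤ K := Nat.cast_nonneg _
    have h2 := Nat.floor_le (show 0 ≤ c * K by positivity)
    have h3 := Nat.lt_floor_add_one (c * K)
    have h4 := Nat.le_ceil ((y.2 : ℝ) * (m y.1.1 : ℝ))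
    rw [← hK] at h4
    have h5 := mul_le_mul_of_nonneg_left h4 hc.le
    have h6 : c * K ≤ c * ((y.2 : ℝ) * m y.1.1) + 1 := by nlinarith
    push_cast
    rw [abs_le]
    constructor <;> linarith [(Nat.cast_nonneg d : (0 : ℝ) ≤ d)]
  have hgap := (h.tendsto_cvarOrderStat hγ hz hj (mul_pos hc ht)).sub
    (h.tendsto_cvarOrderStat hγ hz hl ht)
  rw [gevCVaR_mul_sub hγ hc ht] at hgap
  have hκ : 0 < gevTailQuantile γ c / (1 - γ) :=
    div_pos (gevTailQuantile_pos hc hc1) (by linarith)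
  have hlim := hgap.log (mul_pos hκ (Real.rpow_pos_of_pos ht _)).ne'
  rw [Real.log_mul hκ.ne' (Real.rpow_pos_of_pos ht _).ne', Real.log_rpow ht] at hlim
  rw [one_div, Real.log_inv, mul_neg, ← neg_mul]
  refine hlim.congr fun y => ?_
  rw [← sub_div, sub_sub_sub_cancel_right]

/-- Logarithms of the power bounds, with `k / m ≥ t`. One event serves all `t`, and positivity of
the gap keeps the convention for `log 0` out of play. -/
theorem exists_eventually_abs_log_gap_le (h : IsAttractedSample P X μ γ a b m) (hγ : γ < 1) {c : ℝ}
    (hc : 0 < c) (hc1 : c < 1) :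
    ∃ K D : ℝ, 0 ≤ K ∧ 0 ≤ D ∧ ∀ᶠ z : ℕ × Ω in whp P, ∀ j l, ∀ t : Set.Ioc (0 : ℝ) 1,
      IsGapRanks c ⌈(t : ℝ) * (m z.1 : ℝ)⌉₊ j l →
      0 < cvarOrderStat (fun i => X i z.2) z.1 j - cvarOrderStat (fun i => X i z.2) z.1 l ∧
      |Real.log ((cvarOrderStat (fun i => X i z.2) z.1 j -
        cvarOrderStat (fun i => X i z.2) z.1 l) / a (z.1 / m z.1))| ≤
        K + D * Real.log (1 / (t : ℝ)) := by
  obtain ⟨C, hC, hup⟩ := h.exists_eventually_gap_le hγ hc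
  obtain ⟨κ, hκ, D, hlow⟩ := h.exists_eventually_le_gap hc hc1
  refine ⟨|Real.log C| + |Real.log κ|, 1 + D, by positivity, by positivity, ?_⟩
  filter_upwards [hup, hlow, eventually_whp_fst (h.inter.1.eventually_gt_atTop 0)]
    with z hz1 hz2 hm j l t hr
  set k := ⌈(t : ℝ) * (m z.1 : ℝ)⌉₊ with hk
  have ht : (0 : ℝ) < t := t.2.1
  have hm' : (0 : ℝ) < m z.1 := by exact_mod_cast hm
  have hkm : k ≤ m z.1 := by
    refine Nat.ceil_le.2 ?_
    have := mul_le_mul_of_nonneg_right t.2.2 hm'.le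
    linarith
  have htk : (t : ℝ) * m z.1 ≤ k := Nat.le_ceil _
  have hk0 : (0 : ℝ) < k := lt_of_lt_of_le (by positivity) htk
  have ha := h.tail.pos (z.1 / m z.1)
  have h1 := hz1 k j l hr hkm
  have h2 := hz2 k j l hr hkm
  set G := (cvarOrderStat (fun i => X i z.2) z.1 j - cvarOrderStat (fun i => X i z.2) z.1 l) /
    a (z.1 / m z.1) with hG
  have hG0 : 0 < G := lt_of_lt_of_le (by positivity) h2
  have htk' : (t : ℝ) ≤ k / m z.1 := by rwa [le_div_iff₀ hm']
  have hlogt : 0 ≤ Real.log (1 / (t : ℝ)) :=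
    Real.log_nonneg (by rw [le_div_iff₀ ht]; linarith [t.2.2])
  have hlogk : -Real.log (1 / (t : ℝ)) ≤ Real.log (k / m z.1) := by
    rw [one_div, Real.log_inv, neg_neg]
    exact Real.log_le_log ht htk'
  have hupper : Real.log G ≤ Real.log C + Real.log (1 / (t : ℝ)) := by
    have e := Real.log_le_log hG0 h1
    rw [Real.log_mul hC.ne' (by positivity), ← inv_div, Real.log_inv] at e
    linarith
  have hlower : Real.log κ - D * Real.log (1 / (t : ℝ)) ≤ Real.log G := by
    have e := Real.log_le_log (by positivity) h2
    rw [Real.log_mul hκ.ne' (by positivity), Real.log_pow] at e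
    have := mul_le_mul_of_nonneg_left hlogk (Nat.cast_nonneg D : (0 : ℝ) ≤ D)
    linarith
  refine ⟨(div_pos_iff_of_pos_right ha).1 hG0, ?_⟩
  have hD : 0 ≤ (D : ℝ) * Real.log (1 / (t : ℝ)) := by positivity
  rw [abs_le]
  constructor <;> linarith [le_abs_self (Real.log C), neg_abs_le (Real.log C),
    le_abs_self (Real.log κ), neg_abs_le (Real.log κ)]

theorem tendsto_cvarEstimator (h : IsAttractedSample P X μ γ a b m) (hγ : γ < 1) {c : ℝ}
    (hc : 0 < c) (hc1 : c < 1) {ν : SignedMeasure (Set.Ioc (0 : ℝ) 1)} (hν : ν ∈ weightClass)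
    {d : ℕ} (hd : ∀ᶠ n in atTop, ∀ᵐ t : Set.Ioc (0 : ℝ) 1 ∂ν.variation,
      IsGapRanks c ⌈(t : ℝ) * (m n : ℝ)⌉₊ (⌊c * (⌈(t : ℝ) * (m n : ℝ)⌉₊ : ℝ)⌋₊ + d)
        (⌈(t : ℝ) * (m n : ℝ)⌉₊ + d)) :
    Tendsto (fun z : ℕ × Ω => cvarEstimator d c ν (m z.1) z.1 (fun i => X i z.2)) (whp P)
      (𝓝 γ) := by
  obtain ⟨hν0, hνi, hν1⟩ := hν
  have : IsFiniteMeasure ν.variation := by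
    rw [← SignedMeasure.totalVariation_eq_variation]; infer_instance
  have := sigmaCompactSpace_Ioc 0 1
  obtain ⟨K, D, hK, hD, hdom⟩ := h.exists_eventually_abs_log_gap_le hγ hc hc1
  set κ := Real.log (gevTailQuantile γ c / (1 - γ)) with hκ
  set G : ℕ × Ω → Set.Ioc (0 : ℝ) 1 → ℝ := fun z t =>
    cvarOrderStat (fun i => X i z.2) z.1 (⌊c * (⌈(t : ℝ) * (m z.1 : ℝ)⌉₊ : ℝ)⌋₊ + d) -
      cvarOrderStat (fun i => X i z.2) z.1 (⌈(t : ℝ) * (m z.1 : ℝ)⌉₊ + d) with hG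
  set f : ℕ × Ω → Set.Ioc (0 : ℝ) 1 → ℝ := fun z t => Real.log (G z t / a (z.1 / m z.1)) with hf
  set B : Set.Ioc (0 : ℝ) 1 → ℝ := fun t => (K + |κ|) + (D + |γ|) * Real.log (1 / (t : ℝ)) with hB
  have hBi : ν.Integrable B := (integrable_const _).add (hνi.const_mul _)
  have hlog0 : ∀ t : Set.Ioc (0 : ℝ) 1, 0 ≤ Real.log (1 / (t : ℝ)) := fun t =>
    Real.log_nonneg (by rw [le_div_iff₀ t.2.1]; linarith [t.2.2])
  -- For fixed `z` the integrand depends on `t` only through the natural number `⌈t * m⌉₊`.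
  have hfm : ∀ z, Measurable (f z) := fun z => by
    have hceil : Measurable fun t : Set.Ioc (0 : ℝ) 1 => ⌈(t : ℝ) * (m z.1 : ℝ)⌉₊ :=
      Nat.measurable_ceil.comp (measurable_subtype_coe.mul_const _)
    exact (measurable_from_nat (f := fun k : ℕ => Real.log
      ((cvarOrderStat (fun i => X i z.2) z.1 (⌊c * (k : ℝ)⌋₊ + d) -
        cvarOrderStat (fun i => X i z.2) z.1 (k + d)) / a (z.1 / m z.1)))).comp hceil
  have hfB : ∀ᶠ z in whp P, ∀ᵐ t ∂ν.variation, 0 < G z t ∧ |f z t| ≤ B t := by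
    filter_upwards [hdom, eventually_whp_fst hd] with z hz hz'
    filter_upwards [hz'] with t ht
    obtain ⟨h1, h2⟩ := hz _ _ t ht
    refine ⟨h1, h2.trans ?_⟩
    have e := mul_nonneg (abs_nonneg γ) (hlog0 t)
    have := abs_nonneg κ
    simp only [hB]
    linarith
  have hcont : Continuous fun t : Set.Ioc (0 : ℝ) 1 => Real.log (1 / (t : ℝ)) := by
    refine Continuous.log (continuous_const.div continuous_subtype_val fun t => t.2.1.ne') ?_
    exact fun t => (one_div_pos.2 t.2.1).ne'
  have hlim := tendsto_integral_signedMeasure_of_dominated ν (L := whp P) (f := f)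
    (g := fun t => κ + γ * Real.log (1 / (t : ℝ))) (B := B) hBi
    (continuous_const.add (continuous_const.mul hcont))
    (fun t => by
      refine (abs_add_le _ _).trans ?_
      rw [abs_mul, abs_of_nonneg (hlog0 t)]
      have := mul_nonneg hD (hlog0 t)
      simp only [hB]
      linarith)
    hfm (hfB.mono fun z hz => hz.mono fun t ht => ht.2)
    (fun t => h.tendsto_log_gap hγ hc hc1 d t)
  have hval : ∫ᵛ t, (κ + γ * Real.log (1 / (t : ℝ))) ∂<•ν = γ := by
    rw [VectorMeasure.integral_fun_add (integrable_const _) (hνi.const_mul _),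
      VectorMeasure.integral_const]
    have := VectorMeasure.integral_fun_smul ν ((ContinuousLinearMap.lsmul ℝ ℝ).flip) γ
      fun t : Set.Ioc (0 : ℝ) 1 => Real.log (1 / (t : ℝ))
    simp only [smul_eq_mul] at this
    rw [this, hν1, hν0]
    simp
  rw [hval] at hlim
  refine hlim.congr' ?_
  filter_upwards [hfB] with z hz
  have hfi : ν.Integrable (f z) := Integrable.mono' hBi (hfm z).aestronglyMeasurable
    (hz.mono fun t ht => ht.2)
  have ha := h.tail.pos (z.1 / m z.1)
  -- The scale `a p` is unknown to the estimator: it enters the logarithm as an additive constant,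
  -- which the zero total mass of `ν` removes.
  have hcongr : (fun t => Real.log (G z t)) =ᵐ[ν.variation]
      fun t => f z t + Real.log (a (z.1 / m z.1)) := by
    filter_upwards [hz] with t ht
    simp only [hf]
    rw [Real.log_div ht.1.ne' ha.ne']
    ring
  rw [cvarEstimator]
  change _ = ∫ᵛ t, Real.log (G z t) ∂<•ν
  rw [VectorMeasure.integral_congr_ae hcongr,
    VectorMeasure.integral_fun_add hfi (integrable_const _), VectorMeasure.integral_const, hν0]
  simp

end IsAttractedSample

theorem theorem1 {Ω : Type*} [MeasurableSpace Ω] (P : Measure Ω) [IsProbabilityMeasure P]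
    (X : ℕ → Ω → ℝ) (μ : Measure ℝ) [IsProbabilityMeasure μ]
    (hX : ∀ i, HasLaw (X i) μ P) (hindep : iIndepFun X P)
    (γ c : ℝ) (hγ : γ < 1) (hF : InDomainOfAttraction (fun x => cdf μ x) γ)
    (hc0 : 0 < c) (hc1 : c < 1)
    (ν : SignedMeasure (Set.Ioc (0 : ℝ) 1)) (hν : ν ∈ weightClass)
    (m : ℕ → ℕ) (hm : IsIntermediate m) :
    TendstoInMeasure P (fun n ω => cvarEstimator 1 c ν (m n) n (fun i => X i ω)) atTop
        (fun _ => γ) ∧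
      ((∀ᶠ n in atTop, ∀ᵐ t : Set.Ioc (0 : ℝ) 1 ∂ν.variation,
          1 ≤ ⌊c * (⌈(t : ℝ) * (m n : ℝ)⌉₊ : ℝ)⌋₊) →
        TendstoInMeasure P (fun n ω => cvarEstimator 0 c ν (m n) n (fun i => X i ω)) atTop
          (fun _ => γ)) := by
  obtain ⟨a, b, hab⟩ := hF.exists_isTailNormalization
  have h : IsAttractedSample P X μ γ a b m := ⟨hX, hindep, hab, hm⟩
  refine ⟨tendstoInMeasure_of_tendsto_whp (h.tendsto_cvarEstimator hγ hc0 hc1 hν ?_), fun hd =>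
    tendstoInMeasure_of_tendsto_whp (h.tendsto_cvarEstimator hγ hc0 hc1 hν ?_)⟩
  · filter_upwards [hm.1.eventually_gt_atTop 0] with n hn
    refine Eventually.of_forall fun t => isGapRanks_one hc0 hc1 (Nat.ceil_pos.2 ?_)
    exact mul_pos t.2.1 (by exact_mod_cast hn)
  · filter_upwards [hd] with n hn
    filter_upwards [hn] with t ht
    exact isGapRanks_zero hc0 hc1 ht
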